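/- Notation. Let $g\ge 0$. Let $W\subset S_{2g}$ be the group of permutations $w$ with $w(2g+1-i)=2g+1-w(i)$ for all $i$ (the Weyl group of $\mathrm{GSp}_{2g}$), let $X_*=\{v\in\mathbb Z^{2g};\ v(1)+v(2g)=v(2)+v(2g-1)=\dots=v(g)+v(g+1)\}$, and let $\widetilde W=X_*\rtimes W$ be the extended affine Weyl group, whose elements are written $t^{x_0}w$ and act on $X_*\otimes\mathbb R$ by $v\mapsto wv+x_0$. Let $W_a=Q^\vee\rtimes W$ be the affine Weyl group ($Q^\vee$ the coroot lattice), with simple reflections $s_{i,i+1}=(i\ \,i{+}1)(2g{-}i\ \,2g{-}i{+}1)$ for $1\le i\le g-1$, $s_g=(g\ \,g{+}1)$ and $s_0=t^{(-1,0,\dots,0,1)}(1\ \,2g)$, and let $\Omega\subset\widetilde W$ be the stabilizer of the base alcove $\{v;\ -1<\langle\beta,v\rangle<0\text{ for all positive roots }\beta\}$, so that $\widetilde W=W_a\rtimes\Omega$. Length $\ell$ and Bruhat order of the Coxeter group $W_a$ are extended to $\widetilde W$ by $\ell(cw)=\ell(w)$, and $cw\le c'w'$ iff $c=c'$ and $w\le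 w'$ ($c,c'\in\Omega$, $w,w'\in W_a$). Let $\mu=(1^{(g)},0^{(g)})$ and $\mathrm{Adm}(\mu)=\{x\in\widetilde W;\ x\le t^{w(\mu)}\text{ for some }w\in W\}$. For $x=t^{x_0}w$ let $\mathcal F(x)=\{i\in\{1,\dots,g\};\ w(i)=i\}$; for $0\le d\le g$ let $\mathrm{Adm}(\mu)^{(d)}$ be the set of $x\in\mathrm{Adm}(\mu)$ with $\#\mathcal F(x)=d$ (the $\mu$-admissible elements of $p$-rank $d$). An element $x\in\mathrm{Adm}(\mu)^{(d)}$ is called of maximal length if $\ell(x)=\max_{x'\in\mathrm{Adm}(\mu)^{(d)}}\ell(x')$. Identify $W$ with $\mathbb F_2^g\rtimes S_g$, where $\sigma\in S_g$ acts by $i\mapsto\sigma(i)$, $2g+1-i\mapsto 2g+1-\sigma(i)$ for $i\le g$, and $u\in\mathbb F_2^g$ interchanges $i$ and $2g+1-i$ exactly for those $i\le g$ with $u(i)=1$. An element $x=t^{x_0}(u\sigma)\in\mathrm{Adm}(\mu)$ is called possibly maximal if, for all $i\in\{1,\dots,g\}$, $u(i)=1$ implies $\sigma(i)=i$. For $\sigma\in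 S_g$ let $C_\sigma=\#\{(i,j)\in\{1,\dots,g\}^2;\ i<j<\sigma(i)<\sigma(j)\}$; we say that $\sigma$ embraces $e$ if $i<e<\sigma(i)$ for some $i$. Proposition. Let $0\le d\le g$ and $x=t^{x_0}(u\sigma)\in\mathrm{Adm}(\mu)^{(d)}$. (1) If $g-d$ is even, then $x$ is of maximal length if and only if $x$ is possibly maximal, $\sigma$ is a product of $\frac{g-d}2$ disjoint transpositions and $C_\sigma=0$. (2) If $g-d$ is odd, then $x$ is of maximal length if and only if $x$ is possibly maximal and one of the following holds: (a) $\sigma$ is a product of $\lfloor\frac{g-d}2\rfloor$ disjoint transpositions, $C_\sigma=0$, and $\sigma$ does not embrace its unique fixed point $e$ that is not contained in $\mathcal F(x)$; (b) $\sigma$ is a product of $\lfloor\frac{g-d}2\rfloor-1$ transpositions and one cycle of order three, all pairwise disjoint, and $C_\sigma=C_{\sigma^{-1}}=0$. -/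

import Mathlib

/-! Index conventions: the set `{1, …, 2g}` is `Fin (2 * g)` and `{1, …, g}` is `Fin g`
(both shifted by one), so that `i ↦ 2g + 1 - i` is `Fin.rev`. -/

namespace GSp

/-- The cocharacter lattice `X_*(T)` of the diagonal torus of `GSp_{2g}`: integer vectors `v`
with `v(1) + v(2g) = v(2) + v(2g-1) = ⋯ = v(g) + v(g+1)`. -/
def cochar (g : ℕ) : AddSubgroup (Fin (2 * g) → ℤ) where
  carrier := {v | ∀ i j, v i + v i.rev = v j + v j.rev}
  zero_mem' := by intro i j; rfl
  add_mem' := by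
    intro a b ha hb i j
    have h1 := ha i j
    have h2 := hb i j
    simp only [Pi.add_apply]
    omega
  neg_mem' := by
    intro a ha i j
    have h1 := ha i j
    simp only [Pi.neg_apply]
    omega

/-- The finite Weyl group `W ⊂ S_{2g}`: the centralizer of `θ = (1 2g)(2 2g-1)⋯(g g+1)`. -/
def weyl (g : ℕ) : Subgroup (Equiv.Perm (Fin (2 * g))) :=
  Subgroup.centralizer {Fin.revPerm}

theorem mem_weyl_iff {g : ℕ} {w : Equiv.Perm (Fin (2 * g))} :
    w ∈ weyl g ↔ ∀ i, w i.rev = (w i).rev := by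
  rw [weyl, Subgroup.mem_centralizer_iff]
  constructor
  · intro h i
    exact (Equiv.ext_iff.1 (h _ rfl) i).symm
  · rintro h _ rfl
    ext1 i
    exact (h i).symm

/-- `W` permutes the coordinates of cocharacters: `(w · v)(i) = v(w⁻¹(i))`. -/
def weylActFun {g : ℕ} (w : weyl g) (v : cochar g) : cochar g :=
  ⟨fun i => v.1 ((w⁻¹ : weyl g).1 i), by
    intro i j
    have h := mem_weyl_iff.1 (w⁻¹ : weyl g).2
    simp only [h]
    exact v.2 _ _⟩

/-- The action of `W` on `X_*(T)` as a homomorphism to the automorphism group. -/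
def weylAct (g : ℕ) : weyl g →* MulAut (Multiplicative (cochar g)) where
  toFun w :=
    { toFun := fun v => Multiplicative.ofAdd (weylActFun w v.toAdd)
      invFun := fun v => Multiplicative.ofAdd (weylActFun w⁻¹ v.toAdd)
      left_inv := by
        intro v
        apply Multiplicative.toAdd.injective
        ext i
        simp [weylActFun]
      right_inv := by
        intro v
        apply Multiplicative.toAdd.injective
        ext i
        simp [weylActFun]
      map_mul' := by
        intro a b
        rfl }
  map_one' := by
    ext v
    simp [weylActFun]
  map_mul' := by
    intro a b
    ext v
    simp [weylActFun]

/-- The extended affine Weyl group `W̃ = X_*(T) ⋊ W` of `GSp_{2g}`. -/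
abbrev ExtAffWeyl (g : ℕ) : Type := Multiplicative (cochar g) ⋊[weylAct g] weyl g

/-- The translation `t^v`. -/
def trans {g : ℕ} (v : cochar g) : ExtAffWeyl g :=
  SemidirectProduct.inl (Multiplicative.ofAdd v)

/-- The inclusion `W ⊂ W̃`. -/
def ofWeyl {g : ℕ} (w : weyl g) : ExtAffWeyl g := SemidirectProduct.inr w

/-- The `X_*(T)`-component `x₀` of `x = t^{x₀} w`. -/
def cocharPart {g : ℕ} (x : ExtAffWeyl g) : cochar g := x.left.toAdd

/-- The `W`-component `w` of `x = t^{x₀} w`. -/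
def weylPart {g : ℕ} (x : ExtAffWeyl g) : weyl g := x.right

/-! ### Roots, the base alcove, the affine Weyl group -/

/-- The coroot of `GSp_{2g}` attached to the root `e_i^* - e_j^*` restricted to `T` (`i ≠ j`).
For `j = 2g+1-i` this root is `2e_i^* - c`, with coroot `e_i - e_{2g+1-i}`. -/
def coroot {g : ℕ} (i j : Fin (2 * g)) : cochar g :=
  ⟨if j = i.rev then Pi.single i 1 - Pi.single i.rev 1
    else Pi.single i 1 - Pi.single j 1 - Pi.single i.rev 1 + Pi.single j.rev 1, by
    intro k l
    have key : ∀ a k : Fin (2 * g), (Pi.single a (1 : ℤ) : Fin (2 * g) → ℤ) k.rev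
        = (Pi.single a.rev (1 : ℤ) : Fin (2 * g) → ℤ) k := by
      intro a k
      simp only [Pi.single_apply, Fin.rev_eq_iff]
    split_ifs
    · simp only [Pi.sub_apply, key, Fin.rev_rev]
      ring
    · simp only [Pi.sub_apply, Pi.add_apply, key, Fin.rev_rev]
      ring⟩

/-- The reflection in `W` attached to the root `e_i^* - e_j^*` restricted to `T`: it is
`(i j)(2g+1-i 2g+1-j)`, respectively `(i j)` if `j = 2g+1-i`. -/
def reflection {g : ℕ} (i j : Fin (2 * g)) : weyl g :=
  ⟨if j = i.rev then Equiv.swap i j else Equiv.swap i j * Equiv.swap i.rev j.rev, by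
    rw [mem_weyl_iff]
    intro k
    split_ifs with h
    · subst h
      simp only [Equiv.swap_apply_def]
      grind [Fin.rev_rev]
    · simp only [Equiv.Perm.mul_apply, Equiv.swap_apply_def]
      grind [Fin.rev_rev]⟩

/-- The coroot lattice `Q^∨`. -/
def corootLattice (g : ℕ) : AddSubgroup (cochar g) :=
  AddSubgroup.closure {v | ∃ i j : Fin (2 * g), i < j ∧ v = coroot i j}

/-- The affine Weyl group `W_a = Q^∨ ⋊ W`, as a subset of `W̃`. -/
def affWeyl (g : ℕ) : Set (ExtAffWeyl g) := {x | cocharPart x ∈ corootLattice g}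

/-- The simple affine reflections: `s_{i,i+1} = (i i+1)(2g-i 2g-i+1)` for `1 ≤ i ≤ g-1`,
`s_g = (g g+1)` and `s_0 = t^{(-1, 0, …, 0, 1)} (1 2g)`. -/
def simpleAffRefl (g : ℕ) : Set (ExtAffWeyl g) :=
  {s | ∃ i j : Fin (2 * g), (i : ℕ) + 1 = j ∧ (j : ℕ) ≤ g ∧ s = ofWeyl (reflection i j)} ∪
  {s | ∃ i j : Fin (2 * g), (i : ℕ) = 0 ∧ (j : ℕ) + 1 = 2 * g ∧
    s = trans (-coroot i j) * ofWeyl (reflection i j)}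

/-- `t^{x₀} w` acts on `X_*(T)_ℝ` by `v ↦ w v + x₀`. -/
def act {g : ℕ} (x : ExtAffWeyl g) (v : Fin (2 * g) → ℝ) : Fin (2 * g) → ℝ :=
  fun i => v (((weylPart x)⁻¹ : weyl g).1 i) + ((cocharPart x).1 i : ℝ)

/-- The base alcove, lying in the anti-dominant chamber: the points `v` of `X_*(T)_ℝ` with
`-1 < ⟨β, v⟩ < 0` for all positive roots `β`. The positive roots `e_i^* - e_j^*`,
`e_i^* + e_j^* - c` (`i < j ≤ g`) and `2e_i^* - c` (`i ≤ g`) are precisely the restrictions of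
the `e_i^* - e_j^*` with `i < j ≤ 2g` to `T`. -/
def baseAlcove (g : ℕ) : Set (Fin (2 * g) → ℝ) :=
  {v | (∀ i j, v i + v i.rev = v j + v j.rev) ∧ ∀ i j, i < j → -1 < v i - v j ∧ v i - v j < 0}

/-- `Ω`: the elements of `W̃` that fix the base alcove. -/
def Omega (g : ℕ) : Set (ExtAffWeyl g) := {x | act x '' baseAlcove g = baseAlcove g}

/-! ### Length and Bruhat order -/

/-- The length of an element of `W_a` in the Coxeter system `(W_a, S_a)`. -/
noncomputable def affLength {g : ℕ} (w : ExtAffWeyl g) : ℕ :=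
  sInf {n | ∃ l : List (ExtAffWeyl g), (∀ s ∈ l, s ∈ simpleAffRefl g) ∧ l.prod = w ∧ l.length = n}

/-- The affine reflections: the `W_a`-conjugates of the simple affine reflections. -/
def affRefl (g : ℕ) : Set (ExtAffWeyl g) :=
  {r | ∃ z ∈ affWeyl g, ∃ s ∈ simpleAffRefl g, r = z * s * z⁻¹}

/-- The Bruhat order of the Coxeter system `(W_a, S_a)`: generated by `a < b` whenever
`b = a r` for a reflection `r` and `b` is longer than `a`. -/
def affBruhat {g : ℕ} : ExtAffWeyl g → ExtAffWeyl g → Prop :=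
  Relation.ReflTransGen fun a b => (∃ r ∈ affRefl g, b = a * r) ∧ affLength a < affLength b

/-- The length on `W̃`: `ℓ(c w) = ℓ(w)` for `c ∈ Ω` and `w ∈ W_a` (such a factorisation
exists and is unique). -/
noncomputable def length {g : ℕ} (x : ExtAffWeyl g) : ℕ :=
  sInf {n | ∃ c ∈ Omega g, ∃ w ∈ affWeyl g, x = c * w ∧ n = affLength w}

/-- The Bruhat order on `W̃`: `c w ≤ c' w'` iff `c = c'` in `Ω` and `w ≤ w'` in `W_a`. -/
def bruhat {g : ℕ} (x y : ExtAffWeyl g) : Prop :=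
  ∃ c ∈ Omega g, ∃ w ∈ affWeyl g, ∃ w' ∈ affWeyl g, x = c * w ∧ y = c * w' ∧ affBruhat w w'

/-! ### Admissible elements -/

/-- The cocharacter `μ = (1, …, 1, 0, …, 0)` (`g` ones, `g` zeros). -/
def mu (g : ℕ) : cochar g :=
  ⟨fun i => if (i : ℕ) < g then 1 else 0, by
    have key : ∀ k : Fin (2 * g), ((if (k : ℕ) < g then 1 else 0 : ℤ) +
        if (k.rev : ℕ) < g then 1 else 0) = 1 := by
      intro k
      have := k.isLt
      rw [Fin.val_rev]
      split_ifs <;> omega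
    intro i j
    simp only [key]⟩

/-- The set `Adm(μ)`: the `x` with `x ≤ t^{w(μ)}` for some `w ∈ W`. -/
def adm (g : ℕ) : Set (ExtAffWeyl g) :=
  {x | ∃ w : weyl g, bruhat x (trans (weylActFun w (mu g)))}

/-- The inclusion `{1, …, g} ⊂ {1, …, 2g}`. -/
def low {g : ℕ} (i : Fin g) : Fin (2 * g) := Fin.castLE (Nat.le_mul_of_pos_left g two_pos) i

/-- `F(x)`: the fixed points in `{1, …, g}` of the `W`-component of `x`. -/
def fixedPts {g : ℕ} (x : ExtAffWeyl g) : Finset (Fin g) :=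
  {i | (weylPart x).1 (low i) = low i}

/-- `Adm(μ)^{(d)}`: the `μ`-admissible elements of `p`-rank `d`, i.e. those whose `W`-component
has exactly `d` fixed points in `{1, …, g}`. -/
def admRank (g d : ℕ) : Set (ExtAffWeyl g) := {x | x ∈ adm g ∧ (fixedPts x).card = d}

/-- `x ∈ Adm(μ)^{(d)}` is of maximal length if no element of `Adm(μ)^{(d)}` is longer. -/
def IsOfMaximalLength {g : ℕ} (d : ℕ) (x : ExtAffWeyl g) : Prop :=
  x ∈ admRank g d ∧ ∀ y ∈ admRank g d, length y ≤ length x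

/-! ### The identification `W = 𝔽₂^g ⋊ S_g` -/

/-- `{1, …, 2g}` as two copies of `{1, …, g}`: `inl i ↦ i` and `inr i ↦ 2g+1-i`. -/
def halves (g : ℕ) : Fin g ⊕ Fin g ≃ Fin (2 * g) where
  toFun := Sum.elim low fun i => (low i).rev
  invFun k := if h : (k : ℕ) < g then Sum.inl ⟨k, h⟩
    else Sum.inr ⟨2 * g - 1 - k, by have := k.isLt; omega⟩
  left_inv := by
    rintro (i | i)
    · simp [low]
    · have := i.isLt
      have h : ¬ (((low i).rev : Fin (2 * g)) : ℕ) < g := by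
        simp only [low, Fin.val_rev, Fin.val_castLE]
        omega
      rw [Sum.elim_inr]
      beta_reduce
      rw [dif_neg h, Sum.inr.injEq, Fin.ext_iff]
      simp only [low, Fin.val_rev, Fin.val_castLE]
      omega
  right_inv := by
    intro k
    have := k.isLt
    by_cases h : (k : ℕ) < g
    · simp [h, low]
    · simp only [h, dite_false, Sum.elim_inr, Fin.ext_iff, low, Fin.val_rev, Fin.val_castLE]
      omega

theorem rev_halves {g : ℕ} (a : Fin g ⊕ Fin g) : (halves g a).rev = halves g a.swap := by
  rcases a with i | i <;> simp [halves]

theorem permCongr_mem_weyl {g : ℕ} {f : Equiv.Perm (Fin g ⊕ Fin g)}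
    (hf : ∀ a, f a.swap = (f a).swap) : (halves g).permCongr f ∈ weyl g := by
  rw [mem_weyl_iff]
  intro k
  obtain ⟨a, rfl⟩ := (halves g).surjective k
  rw [rev_halves]
  simp only [Equiv.permCongr_apply, Equiv.symm_apply_apply, hf, rev_halves]

/-- `σ ∈ S_g` as an element of `W`: `i ↦ σ(i)` and `2g+1-i ↦ 2g+1-σ(i)` for `i ≤ g`. -/
def ofPerm {g : ℕ} (σ : Equiv.Perm (Fin g)) : weyl g :=
  ⟨(halves g).permCongr (Equiv.sumCongr σ σ),
    permCongr_mem_weyl (by rintro (i | i) <;> simp)⟩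

/-- The map interchanging `inl i` and `inr i` if `u(i) = 1` and fixing them if `u(i) = 0`. -/
def flipFun {g : ℕ} (u : Fin g → ZMod 2) : Fin g ⊕ Fin g → Fin g ⊕ Fin g :=
  Sum.elim (fun i => if u i = 1 then Sum.inr i else Sum.inl i)
    (fun i => if u i = 1 then Sum.inl i else Sum.inr i)

theorem flipFun_flipFun {g : ℕ} (u : Fin g → ZMod 2) (a : Fin g ⊕ Fin g) :
    flipFun u (flipFun u a) = a := by
  rcases a with i | i <;> by_cases h : u i = 1 <;> simp [flipFun, h]

theorem flipFun_swap {g : ℕ} (u : Fin g → ZMod 2) (a : Fin g ⊕ Fin g) :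
    flipFun u a.swap = (flipFun u a).swap := by
  rcases a with i | i <;> by_cases h : u i = 1 <;> simp [flipFun, h]

/-- `u ∈ 𝔽₂^g` as an element of `W`: `i ≤ g` and `2g+1-i` are fixed if `u(i) = 0` and
interchanged if `u(i) = 1`. -/
def ofSigns {g : ℕ} (u : Fin g → ZMod 2) : weyl g :=
  ⟨(halves g).permCongr ⟨flipFun u, flipFun u, flipFun_flipFun u, flipFun_flipFun u⟩,
    permCongr_mem_weyl (flipFun_swap u)⟩

/-- The element `t^{x₀} (u σ)` of `W̃`. -/
def mk {g : ℕ} (x₀ : cochar g) (u : Fin g → ZMod 2) (σ : Equiv.Perm (Fin g)) : ExtAffWeyl g :=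
  trans x₀ * ofWeyl (ofSigns u * ofPerm σ)

/-- Every element of `W̃` has exactly one presentation `t^{x₀} (u σ)`. -/
theorem existsUnique_mk {g : ℕ} (x : ExtAffWeyl g) :
    ∃! p : cochar g × (Fin g → ZMod 2) × Equiv.Perm (Fin g), x = mk p.1 p.2.1 p.2.2 := by
  have hz : ∀ z : ZMod 2, z = 0 ∨ z = 1 := by decide
  have hval : ∀ (u : Fin g → ZMod 2) (σ : Equiv.Perm (Fin g)) (i : Fin g),
      (ofSigns u * ofPerm σ).1 (halves g (Sum.inl i)) =
        halves g (if u (σ i) = 1 then Sum.inr (σ i) else Sum.inl (σ i)) := by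
    intro u σ i
    simp [ofSigns, ofPerm, Equiv.permCongr_apply, flipFun]
  have hmk : ∀ (v : cochar g) (w : weyl g), x = trans v * ofWeyl w ↔
      cocharPart x = v ∧ weylPart x = w := by
    intro v w
    constructor
    · rintro rfl
      simp [trans, ofWeyl, cocharPart, weylPart]
    · rintro ⟨rfl, rfl⟩
      ext <;> simp [trans, ofWeyl, cocharPart, weylPart]
  have hext : ∀ w w' : weyl g,
      (∀ i, w.1 (halves g (Sum.inl i)) = w'.1 (halves g (Sum.inl i))) → w = w' := by
    intro w w' h
    apply Subtype.ext
    apply Equiv.ext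
    intro k
    obtain ⟨a, rfl⟩ := (halves g).surjective k
    rcases a with i | i
    · exact h i
    · have h2 : halves g (Sum.inr i) = (halves g (Sum.inl i)).rev := by simp [rev_halves]
      rw [h2, mem_weyl_iff.1 w.2, mem_weyl_iff.1 w'.2, h i]
  set w := weylPart x with hw
  let r : Fin g → Fin g ⊕ Fin g := fun i => (halves g).symm (w.1 (halves g (Sum.inl i)))
  have hr : ∀ i, w.1 (halves g (Sum.inl i)) = halves g (r i) := by
    intro i
    simp [r]
  have hinj : Function.Injective fun i => Sum.elim id id (r i) := by
    intro i j hij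
    have h1 : r i = r j ∨ r i = (r j).swap := by
      rcases hi : r i with a | a <;> rcases hj : r j with b | b <;> simp_all
    rcases h1 with h1 | h1
    · have h2 := congrArg (halves g) h1
      rw [← hr, ← hr] at h2
      simpa using h2
    · have h2 := congrArg (halves g) h1
      rw [← rev_halves, ← hr, ← hr, ← mem_weyl_iff.1 w.2, rev_halves] at h2
      simp at h2
  let σ : Equiv.Perm (Fin g) := Equiv.ofBijective _ (Finite.injective_iff_bijective.1 hinj)
  have hσ : ∀ i, σ i = Sum.elim id id (r i) := fun i => rfl
  let u : Fin g → ZMod 2 := fun i => if (r (σ.symm i)).isRight then 1 else 0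
  refine ⟨(cocharPart x, u, σ), (hmk _ _).2 ⟨rfl, hext _ _ fun i => ?_⟩, ?_⟩
  · rw [hval, hr]
    congr 1
    have hu : u (σ i) = if (r i).isRight then 1 else 0 := by
      simp only [u, Equiv.symm_apply_apply]
    change r i = if u (σ i) = 1 then Sum.inr (σ i) else Sum.inl (σ i)
    rw [hu, hσ]
    rcases r i with a | a <;> simp
  · rintro ⟨v', u', σ'⟩ h
    obtain ⟨h1, h2⟩ := (hmk _ _).1 h
    simp only at h1 h2
    have h3 : ∀ i, r i = if u' (σ' i) = 1 then Sum.inr (σ' i) else Sum.inl (σ' i) := by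
      intro i
      apply (halves g).injective
      rw [← hr, ← hval, ← h2]
    have h4 : σ' = σ := by
      ext i
      rw [hσ, h3]
      split_ifs <;> rfl
    subst h4
    have h5 : u' = u := by
      funext i
      simp only [u]
      rw [h3]
      simp only [Equiv.apply_symm_apply]
      rcases hz (u' i) with h0 | h0 <;> simp [h0]
    rw [h1, h5]

/-- `x = t^{x₀} (u σ)` is possibly maximal if it is `μ`-admissible and `u(i) = 1` implies
`σ(i) = i`. -/
def PossiblyMaximal {g : ℕ} (x₀ : cochar g) (u : Fin g → ZMod 2) (σ : Equiv.Perm (Fin g)) : Prop :=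
  mk x₀ u σ ∈ adm g ∧ ∀ i, u i = 1 → σ i = i

/-! ### Combinatorics of permutations -/

/-- `C_σ = #{(i, j) ; i < j < σ(i) < σ(j)}`. -/
def crossings {g : ℕ} (σ : Equiv.Perm (Fin g)) : ℕ :=
  Finset.card {p : Fin g × Fin g | p.1 < p.2 ∧ p.2 < σ p.1 ∧ σ p.1 < σ p.2}

/-- `σ` embraces `e` if `i < e < σ(i)` for some `i`. -/
def Embraces {g : ℕ} (σ : Equiv.Perm (Fin g)) (e : Fin g) : Prop := ∃ i, i < e ∧ e < σ i

/-- `σ` is a product of `k` pairwise disjoint transpositions. -/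
def IsProdTranspositions {g : ℕ} (σ : Equiv.Perm (Fin g)) (k : ℕ) : Prop :=
  σ.cycleType = Multiset.replicate k 2

/-- `σ` is a product of `k` transpositions and one cycle of order three, all pairwise disjoint. -/
def IsProdTranspositionsThreeCycle {g : ℕ} (σ : Equiv.Perm (Fin g)) (k : ℕ) : Prop :=
  σ.cycleType = 3 ::ₘ Multiset.replicate k 2

end GSp

/-! Write `w` for the permutation of {1, …, 2g} underlying `x`. The theorem follows from an exact
length formula: for admissible `x` of `p`-rank `d`, 4ℓ(x) + 2(g − d) + excess(w) = 2g² + 2g, where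
excess(w) = 2C_w + 2C_{w⁻¹} + flips(w) + doubles(w). Here `flips` counts the points sent to the
other half of {1, …, 2g}, and `doubles` counts the points lying in the middle of a monotone chain
w⁻¹(j), j, w(j).

The length is a quarter of a weighted count of the root hyperplanes separating two alcoves
(`four_mul_length`). Admissible elements satisfy a vertexwise condition, `IsPermissible`: every
offset v(w(i)) is 0 or 1, with w(i) ≤ i in the first case and w(i) ≥ i in the second
(`isPermissible_of_mem_adm`). Under this condition each term of the count is determined by the order
of two positions and of their images, so the count becomes a signed count of inversions. Balancing
upward against downward moves across each cut of {1, …, 2g} turns it into the formula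
(`sum_inversions`, `wallSum_of_isPermissible`).

The excess is nonnegative and congruent to 2(g − d) modulo 4, so it is at least 0 or 2 according to
the parity of g − d. Multiplying a suitable translation t^{wμ} by commuting simple reflections
attains this bound (`exists_mem_admRank`). Maximal length thus means excess 0 or 2
(`isOfMaximalLength_iff`).

It remains to read the excess off (u, σ). Symmetry gives C_w = C_{w⁻¹}, so in the extremal case `w`
has no crossings. A permutation for which C_w, C_{w⁻¹} and `doubles` vanish is an involution
(`involutive_of_noncrossing`); this settles excess 0. Excess 2 comes either from one flipped index,
which must be a fixed point of σ that is not embraced, or from exactly one double point of σ;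
bypassing that point leaves an involution, so σ has one three-cycle
(`exists_threeCycle_of_noncrossing`). -/

namespace GSp

variable {g : ℕ}

/-! ### Coordinates on the extended affine Weyl group -/

/-- The permutation of `{1, …, 2g}` underlying `x = t^v w`. -/
def perm (x : ExtAffWeyl g) : Equiv.Perm (Fin (2 * g)) := (weylPart x).1

/-- The function `i ↦ v(w(i))` for `x = t^v w`. -/
def offset (x : ExtAffWeyl g) (i : Fin (2 * g)) : ℤ := (cocharPart x).1 (perm x i)

theorem rev_ne (i : Fin (2 * g)) : i.rev ≠ i := by
  intro h
  have := congrArg Fin.val h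
  rw [Fin.val_rev] at this
  omega

theorem perm_one : perm (1 : ExtAffWeyl g) = 1 := rfl

theorem perm_mul_apply (x y : ExtAffWeyl g) (i) : perm (x * y) i = perm x (perm y i) := rfl

theorem perm_rev (x : ExtAffWeyl g) (i) : perm x i.rev = (perm x i).rev :=
  mem_weyl_iff.1 (weylPart x).2 i

theorem perm_symm_rev (x : ExtAffWeyl g) (i) :
    (perm x).symm i.rev = ((perm x).symm i).rev := by
  rw [Equiv.symm_apply_eq, perm_rev, Equiv.apply_symm_apply]

theorem offset_one (i) : offset (1 : ExtAffWeyl g) i = 0 := rfl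

/-- Reading the translation part at w(i) rather than at i makes it a cocycle, so that no inverse
permutation enters later computations. -/
theorem offset_mul (x y : ExtAffWeyl g) (i) :
    offset (x * y) i = offset x (perm y i) + offset y i := by
  have h : cocharPart (x * y) = cocharPart x + weylActFun (weylPart x) (cocharPart y) := rfl
  rw [offset, h, perm_mul_apply]
  change _ + (cocharPart y).1 ((perm x).symm (perm x (perm y i))) = _
  rw [Equiv.symm_apply_apply]
  rfl

theorem offset_rev (x : ExtAffWeyl g) (i j) :
    offset x i + offset x i.rev = offset x j + offset x j.rev := by
  simp only [offset, perm_rev]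
  exact (cocharPart x).2 _ _

theorem ext_of_perm_of_offset {x y : ExtAffWeyl g} (h1 : ∀ i, perm x i = perm y i)
    (h2 : ∀ i, offset x i = offset y i) : x = y := by
  have hp : perm x = perm y := Equiv.ext h1
  refine SemidirectProduct.ext ?_ (Subtype.ext hp)
  apply Multiplicative.toAdd.injective
  apply Subtype.ext
  funext k
  have := h2 ((perm x).symm k)
  simp only [offset, ← hp, Equiv.apply_symm_apply] at this
  exact this

theorem perm_trans_mul (v : cochar g) (w : weyl g) (i) : perm (trans v * ofWeyl w) i = w.1 i := rfl

theorem offset_trans_mul (v : cochar g) (w : weyl g) (i) :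
    offset (trans v * ofWeyl w) i = v.1 (w.1 i) := by
  rw [offset_mul]
  change v.1 (w.1 i) + 0 = _
  rw [add_zero]

theorem perm_trans (v : cochar g) (i) : perm (trans v) i = i := rfl

theorem offset_trans (v : cochar g) (i) : offset (trans v) i = v.1 i := rfl

/-- The coroots e_i − e_{2g+1−i} of the long roots already span the vectors of multiplier zero, with
the first g entries as coefficients. -/
theorem mem_corootLattice_iff {v : cochar g} :
    v ∈ corootLattice g ↔ ∀ i, v.1 i + v.1 i.rev = 0 := by
  constructor
  · intro h
    induction h using AddSubgroup.closure_induction with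
    | mem v hv =>
      obtain ⟨i, j, hij, rfl⟩ := hv
      intro k
      have key : ∀ a k : Fin (2 * g), (Pi.single a (1 : ℤ) : Fin (2 * g) → ℤ) k.rev
          = (Pi.single a.rev (1 : ℤ) : Fin (2 * g) → ℤ) k := by
        intro a k
        simp only [Pi.single_apply, Fin.rev_eq_iff]
      simp only [coroot]
      split_ifs
      · simp only [Pi.sub_apply, key, Fin.rev_rev]
        ring
      · simp only [Pi.sub_apply, Pi.add_apply, key, Fin.rev_rev]
        ring
    | zero => intro i; rfl
    | add a b _ _ ha hb =>
      intro i
      have h1 := ha i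
      have h2 := hb i
      change a.1 i + b.1 i + (a.1 i.rev + b.1 i.rev) = 0
      omega
    | neg a _ ha =>
      intro i
      have h1 := ha i
      change -a.1 i + -a.1 i.rev = 0
      omega
  · intro h
    have key : v = ∑ i : Fin g, v.1 (low i) • coroot (low i) (low i).rev := by
      apply Subtype.ext
      funext k
      have h1 : (∑ i : Fin g, v.1 (low i) • coroot (low i) (low i).rev).1 k =
          ∑ i : Fin g, v.1 (low i) * (coroot (low i) (low i).rev).1 k := by
        have := map_sum ((Pi.evalAddMonoidHom (fun _ : Fin (2 * g) => ℤ) k).comp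
          (cochar g).subtype) (fun i : Fin g => v.1 (low i) • coroot (low i) (low i).rev)
          Finset.univ
        refine this.trans ?_
        refine Finset.sum_congr rfl fun i _ => ?_
        simp
      rw [h1]
      obtain ⟨a, rfl⟩ := (halves g).surjective k
      have hlow : ∀ i j : Fin g, low i = low j ↔ i = j := by
        intro i j
        simp [low, Fin.ext_iff]
      have hlowrev : ∀ i j : Fin g, low i ≠ (low j).rev := by
        intro i j h
        have := congrArg Fin.val h
        have hi := i.isLt
        have hj := j.isLt
        simp only [low, Fin.val_rev, Fin.val_castLE] at this
        omega
      rcases a with a | a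
      · rw [Finset.sum_eq_single a]
        · simp [coroot, halves, hlowrev]
        · intro b _ hb
          simp [coroot, halves, hlowrev, hlow, Ne.symm hb]
        · simp
      · rw [Finset.sum_eq_single a]
        · have := h (low a)
          simp [coroot, halves, (hlowrev _ _).symm]
          omega
        · intro b _ hb
          simp [coroot, halves, (hlowrev _ _).symm, hlow, Ne.symm hb]
        · simp
    rw [key]
    refine sum_mem fun i _ => zsmul_mem (AddSubgroup.subset_closure ?_) _
    refine ⟨_, _, ?_, rfl⟩
    rw [Fin.lt_def]
    have hi := i.isLt
    simp only [low, Fin.val_rev, Fin.val_castLE]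
    omega

theorem mem_affWeyl_iff {x : ExtAffWeyl g} :
    x ∈ affWeyl g ↔ ∀ i, offset x i + offset x i.rev = 0 := by
  change cocharPart x ∈ corootLattice g ↔ _
  rw [mem_corootLattice_iff]
  simp only [offset, perm_rev]
  exact (perm x).forall_congr_right (q := fun i => (cocharPart x).1 i + _ = 0) |>.symm

theorem mul_mem_affWeyl {x y : ExtAffWeyl g} (hx : x ∈ affWeyl g) (hy : y ∈ affWeyl g) :
    x * y ∈ affWeyl g := by
  rw [mem_affWeyl_iff] at *
  intro i
  have h1 := hx (perm y i)
  have h2 := hy i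
  rw [offset_mul, offset_mul, perm_rev]
  omega

/-! ### Affine reflections -/

theorem reflection_apply {i j : Fin (2 * g)} (k : Fin (2 * g)) :
    (reflection i j).1 k = if k = i then j else if k = j then i else if k = i.rev then j.rev
      else if k = j.rev then i.rev else k := by
  have h1 := rev_ne i
  have h2 := rev_ne j
  simp only [reflection]
  split_ifs <;> simp only [Equiv.Perm.mul_apply, Equiv.swap_apply_def] <;> grind [Fin.rev_rev]

theorem coroot_apply {i j : Fin (2 * g)} (hij : i ≠ j) (k : Fin (2 * g)) :
    (coroot i j).1 k = if k = i then 1 else if k = j then -1 else if k = i.rev then -1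
      else if k = j.rev then 1 else 0 := by
  have h1 := rev_ne i
  have h2 := rev_ne j
  simp only [coroot]
  by_cases h : j = i.rev
  · subst h
    simp [Pi.single_apply]
    grind
  · simp [Pi.single_apply, h]
    grind [Fin.rev_rev]

/-- The affine reflection attached to the affine root `(i, j, q)`. -/
def affReflection (i j : Fin (2 * g)) (q : ℤ) : ExtAffWeyl g :=
  trans (q • coroot i j) * ofWeyl (reflection i j)

theorem perm_affReflection {i j : Fin (2 * g)} (q : ℤ) (k) :
    perm (affReflection i j q) k = if k = i then j else if k = j then i else
      if k = i.rev then j.rev else if k = j.rev then i.rev else k :=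
  reflection_apply k

theorem offset_affReflection {i j : Fin (2 * g)} (hij : i ≠ j) (q : ℤ) (k) :
    offset (affReflection i j q) k = if k = i then -q else if k = j then q else
      if k = i.rev then q else if k = j.rev then -q else 0 := by
  have h1 := rev_ne i
  have h2 := rev_ne j
  have h : offset (affReflection i j q) k = q * (coroot i j).1 ((reflection i j).1 k) := by
    rw [affReflection, offset_trans_mul]
    simp
  rw [h, reflection_apply, coroot_apply hij]
  grind [Fin.rev_rev]

theorem affReflection_swap {i j : Fin (2 * g)} (hij : i ≠ j) (q : ℤ) :
    affReflection j i (-q) = affReflection i j q := by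
  have h1 := rev_ne i
  have h2 := rev_ne j
  apply ext_of_perm_of_offset
  · intro k
    simp only [perm_affReflection]
    grind [Fin.rev_rev]
  · intro k
    simp only [offset_affReflection hij, offset_affReflection hij.symm]
    grind [Fin.rev_rev]

theorem affReflection_rev {i j : Fin (2 * g)} (hij : i ≠ j) (q : ℤ) :
    affReflection j.rev i.rev q = affReflection i j q := by
  have h1 := rev_ne i
  have h2 := rev_ne j
  have h3 : j.rev ≠ i.rev := fun h => hij (Fin.rev_injective h).symm
  apply ext_of_perm_of_offset
  · intro k
    simp only [perm_affReflection]
    grind [Fin.rev_rev]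
  · intro k
    simp only [offset_affReflection hij, offset_affReflection h3]
    grind [Fin.rev_rev]

theorem affReflection_mul_self {i j : Fin (2 * g)} (hij : i ≠ j) (q : ℤ) :
    affReflection i j q * affReflection i j q = 1 := by
  have h1 := rev_ne i
  have h2 := rev_ne j
  apply ext_of_perm_of_offset
  · intro k
    simp only [perm_mul_apply, perm_affReflection, perm_one, Equiv.Perm.one_apply]
    grind [Fin.rev_rev]
  · intro k
    simp only [offset_mul, offset_affReflection hij, perm_affReflection, offset_one]
    grind [Fin.rev_rev]

/-- Conjugating a reflection by `z` gives the reflection in the transported affine root; multiplying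
through by `z` avoids the inverse. -/
theorem mul_affReflection (z : ExtAffWeyl g) {i j : Fin (2 * g)} (hij : i ≠ j) (q : ℤ) :
    z * affReflection i j q =
      affReflection (perm z i) (perm z j) (q + offset z i - offset z j) * z := by
  have h1 := rev_ne i
  have h2 := rev_ne j
  have hz : perm z i ≠ perm z j := fun h => hij ((perm z).injective h)
  have hr : ∀ a b, perm z a = perm z b ↔ a = b := fun a b => (perm z).injective.eq_iff
  apply ext_of_perm_of_offset
  · intro k
    simp only [perm_mul_apply, perm_affReflection, ← perm_rev, hr]
    grind
  · intro k
    have h3 := offset_rev z i j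
    simp only [offset_mul, offset_affReflection hij, offset_affReflection hz,
      perm_affReflection, ← perm_rev, hr]
    grind [Fin.rev_rev]

theorem affReflection_mem_affWeyl {i j : Fin (2 * g)} (hij : i ≠ j) (q : ℤ) :
    affReflection i j q ∈ affWeyl g := by
  have h1 := rev_ne i
  have h2 := rev_ne j
  rw [mem_affWeyl_iff]
  intro k
  simp only [offset_affReflection hij]
  grind [Fin.rev_rev]

/-! ### Counting separating walls -/

/-- The indicator of `i < j`. -/
def ltInd (i j : Fin (2 * g)) : ℤ := if i < j then 1 else 0

/-- The signed number of affine root hyperplanes in direction `(i, j)` separating the base alcove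
from its image under `x⁻¹`. -/
def walls (x : ExtAffWeyl g) (i j : Fin (2 * g)) : ℤ :=
  offset x i - offset x j - ltInd (perm x j) (perm x i) + ltInd j i

theorem walls_one (i j : Fin (2 * g)) : walls 1 i j = 0 := by
  simp [walls, offset_one, perm_one]

/-- The offsets form a cocycle and the two order indicators a coboundary, so their sum is again a
cocycle. -/
theorem walls_mul (x y : ExtAffWeyl g) (i j) :
    walls (x * y) i j = walls x (perm y i) (perm y j) + walls y i j := by
  simp only [walls, offset_mul, perm_mul_apply]
  ring

theorem walls_self (x : ExtAffWeyl g) (i) : walls x i i = 0 := by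
  simp [walls, ltInd]

theorem walls_swap (x : ExtAffWeyl g) (i j) : walls x j i = -walls x i j := by
  rcases eq_or_ne i j with rfl | hij
  · simp [walls, ltInd]
  · have h : perm x i ≠ perm x j := fun h => hij ((perm x).injective h)
    simp only [walls, ltInd]
    grind

theorem walls_rev (x : ExtAffWeyl g) (i j) : walls x j.rev i.rev = walls x i j := by
  have := offset_rev x i j
  simp only [walls, ltInd, perm_rev, Fin.rev_lt_rev]
  linarith

/-- The pairs `(a, b)` such that `affReflection a b [b < a]` is a simple affine reflection. -/
def IsSimplePair (a b : Fin (2 * g)) : Prop :=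
  ((a : ℕ) + 1 = b ∧ (b : ℕ) ≤ g) ∨ ((a : ℕ) + 1 = 2 * g ∧ (b : ℕ) = 0)

theorem IsSimplePair.ne {a b : Fin (2 * g)} (h : IsSimplePair a b) : a ≠ b := by
  rintro rfl
  rcases h with h | h <;> omega

/-- The simple affine reflection attached to a simple pair. -/
def simpleReflection (a b : Fin (2 * g)) : ExtAffWeyl g :=
  affReflection a b (if b < a then 1 else 0)

theorem mem_simpleAffRefl_iff {s : ExtAffWeyl g} :
    s ∈ simpleAffRefl g ↔ ∃ a b, IsSimplePair a b ∧ s = simpleReflection a b := by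
  have hzero : ∀ i j : Fin (2 * g), affReflection i j 0 = ofWeyl (reflection i j) := by
    intro i j
    rw [affReflection, zero_smul]
    exact one_mul _
  have hneg : ∀ i j : Fin (2 * g),
      affReflection i j (-1) = trans (-coroot i j) * ofWeyl (reflection i j) := by
    intro i j
    rw [affReflection, neg_one_smul]
  constructor
  · rintro (⟨i, j, h1, h2, rfl⟩ | ⟨i, j, h1, h2, rfl⟩)
    · have h : ¬ j < i := by
        rw [Fin.lt_def]
        omega
      exact ⟨i, j, .inl ⟨h1, h2⟩, by rw [simpleReflection, if_neg h, hzero]⟩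
    · have h : i < j := by
        rw [Fin.lt_def]
        omega
      exact ⟨j, i, .inr ⟨h2, h1⟩, by
        rw [simpleReflection, if_pos h, ← hneg, affReflection_swap h.ne']⟩
  · rintro ⟨a, b, h | h, rfl⟩
    · have h' : ¬ b < a := by
        rw [Fin.lt_def]
        omega
      exact .inl ⟨a, b, h.1, h.2, by rw [simpleReflection, if_neg h', hzero]⟩
    · have h' : b < a := by
        rw [Fin.lt_def]
        omega
      exact .inr ⟨b, a, h.2, h.1, by
        rw [simpleReflection, if_pos h', ← hneg, affReflection_swap h'.ne']⟩

theorem simpleReflection_mul_self {a b : Fin (2 * g)} (h : IsSimplePair a b) :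
    simpleReflection a b * simpleReflection a b = 1 :=
  affReflection_mul_self h.ne _

theorem simpleReflection_mem_affWeyl {a b : Fin (2 * g)} (h : IsSimplePair a b) :
    simpleReflection a b ∈ affWeyl g :=
  affReflection_mem_affWeyl h.ne _

-- A simple reflection carries the base alcove across one wall only, so only the corresponding root,
-- its negative and their mirror images contribute.
set_option maxHeartbeats 1000000 in
theorem walls_simpleReflection {a b : Fin (2 * g)} (h : IsSimplePair a b) (i j : Fin (2 * g)) :
    walls (simpleReflection a b) i j =
      if (i = a ∧ j = b) ∨ (i = b.rev ∧ j = a.rev) then -1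
      else if (i = b ∧ j = a) ∨ (i = a.rev ∧ j = b.rev) then 1 else 0 := by
  have hi := i.isLt
  have hj := j.isLt
  have ha := a.isLt
  have hb := b.isLt
  have key : ∀ k : Fin (2 * g), ((k : ℕ) = a ∧ (perm (simpleReflection a b) k : ℕ) = b ∧
        offset (simpleReflection a b) k = -(if (b : ℕ) < a then 1 else 0)) ∨
      ((k : ℕ) = b ∧ (perm (simpleReflection a b) k : ℕ) = a ∧
        offset (simpleReflection a b) k = if (b : ℕ) < a then 1 else 0) ∨
      ((k : ℕ) = 2 * g - (a + 1) ∧ (perm (simpleReflection a b) k : ℕ) = 2 * g - (b + 1) ∧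
        offset (simpleReflection a b) k = if (b : ℕ) < a then 1 else 0) ∨
      ((k : ℕ) = 2 * g - (b + 1) ∧ (perm (simpleReflection a b) k : ℕ) = 2 * g - (a + 1) ∧
        offset (simpleReflection a b) k = -(if (b : ℕ) < a then 1 else 0)) ∨
      (((k : ℕ) ≠ a ∧ (k : ℕ) ≠ b ∧ (k : ℕ) ≠ 2 * g - (a + 1) ∧ (k : ℕ) ≠ 2 * g - (b + 1)) ∧
        (perm (simpleReflection a b) k : ℕ) = k ∧ offset (simpleReflection a b) k = 0) := by
    intro k
    simp only [simpleReflection, perm_affReflection, offset_affReflection h.ne, Fin.lt_def,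
      Fin.ext_iff, Fin.val_rev, apply_ite Fin.val]
    split_ifs <;> omega
  simp only [walls, ltInd, Fin.ext_iff, Fin.lt_def, Fin.val_rev]
  rcases h with h | h
  · have hq : (if (b : ℕ) < a then (1 : ℤ) else 0) = 0 := if_neg (by omega)
    simp only [hq] at key
    rcases key i with hki | hki | hki | hki | hki <;>
      rcases key j with hkj | hkj | hkj | hkj | hkj <;>
      rw [hki.2.1, hki.2.2, hkj.2.1, hkj.2.2] <;> grind
  · have hq : (if (b : ℕ) < a then (1 : ℤ) else 0) = 1 := if_pos (by omega)
    simp only [hq] at key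
    rcases key i with hki | hki | hki | hki | hki <;>
      rcases key j with hkj | hkj | hkj | hkj | hkj <;>
      rw [hki.2.1, hki.2.2, hkj.2.1, hkj.2.2] <;> grind

/-- Four times the number of affine root hyperplanes separating the base alcove from its image
under `x`. -/
def wallSum (x : ExtAffWeyl g) : ℤ :=
  ∑ p : Fin (2 * g) × Fin (2 * g), (if p.2 = p.1.rev then 2 else 1) * |walls x p.1 p.2|

theorem wallSum_one : wallSum (1 : ExtAffWeyl g) = 0 := by
  simp [wallSum, walls_one]

theorem wallSum_nonneg (x : ExtAffWeyl g) : 0 ≤ wallSum x := by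
  refine Finset.sum_nonneg fun p _ => mul_nonneg ?_ (abs_nonneg _)
  split_ifs <;> norm_num

theorem wallSum_mul_of_walls_eq_zero {c : ExtAffWeyl g} (hc : ∀ i j, walls c i j = 0)
    (x : ExtAffWeyl g) : wallSum (c * x) = wallSum x := by
  simp only [wallSum, walls_mul, hc, zero_add]

/-- Each root direction is represented by the four pairs obtained from (a, b) by swapping and
mirroring. If b is the mirror of a only two of them are distinct, and the weight 2 makes up for it.
Either way the factor is 4. -/
theorem wallSum_mul_simpleReflection (x : ExtAffWeyl g) {a b : Fin (2 * g)}
    (h : IsSimplePair a b) :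
    wallSum (x * simpleReflection a b) = wallSum x + 4 * (|walls x a b + 1| - |walls x a b|) := by
  set s := simpleReflection a b with hs
  set t := walls x a b with ht
  have h1 : wallSum (x * s) = ∑ p : Fin (2 * g) × Fin (2 * g),
      (if p.2 = p.1.rev then 2 else 1) * |walls x p.1 p.2 - walls s p.1 p.2| := by
    rw [wallSum]
    -- Reindexing by `s` turns the cocycle rule into a subtraction, because s² = 1 gives walls s (s
    -- i) (s j) = −walls s i j.
    refine Fintype.sum_equiv (Equiv.prodCongr (perm s) (perm s)) _ _ fun p => ?_
    have h2 := walls_mul s s p.1 p.2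
    rw [simpleReflection_mul_self h, walls_one] at h2
    simp only [Equiv.prodCongr_apply, Prod.map_fst, Prod.map_snd, walls_mul]
    simp only [← perm_rev, (perm s).injective.eq_iff]
    congr 2
    omega
  have h2 : ∀ p : Fin (2 * g) × Fin (2 * g),
      (if p.2 = p.1.rev then 2 else 1) * |walls x p.1 p.2 - walls s p.1 p.2| -
        (if p.2 = p.1.rev then 2 else 1) * |walls x p.1 p.2| =
      (if p ∈ ({(a, b), (b, a), (b.rev, a.rev), (a.rev, b.rev)} : Finset _) then
        (if b = a.rev then 2 else 1) else 0) * (|t + 1| - |t|) := by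
    rintro ⟨i, j⟩
    have hsw := walls_swap x a b
    have hr := walls_rev x a b
    have hsr := walls_rev x b a
    have habs : |-t - 1| - |-t| = |t + 1| - |t| := by
      rw [abs_neg, ← abs_neg (t + 1), neg_add']
    have hab := h.ne
    simp only [hs, walls_simpleReflection h, Finset.mem_insert, Finset.mem_singleton,
      Prod.mk.injEq]
    by_cases c1 : (i = a ∧ j = b) ∨ (i = b.rev ∧ j = a.rev)
    · rw [if_pos c1, if_pos (show i = a ∧ j = b ∨ _ by tauto)]
      have e1 : walls x i j = t := by
        rcases c1 with ⟨rfl, rfl⟩ | ⟨rfl, rfl⟩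
        · rfl
        · exact hr
      have e2 : j = i.rev ↔ b = a.rev := by
        rcases c1 with ⟨rfl, rfl⟩ | ⟨rfl, rfl⟩
        · rfl
        · grind [Fin.rev_rev]
      simp only [e1, e2, sub_neg_eq_add]
      ring
    · rw [if_neg c1]
      by_cases c2 : (i = b ∧ j = a) ∨ (i = a.rev ∧ j = b.rev)
      · rw [if_pos c2, if_pos (show i = a ∧ j = b ∨ _ by tauto)]
        have e1 : walls x i j = -t := by
          rcases c2 with ⟨rfl, rfl⟩ | ⟨rfl, rfl⟩
          · exact hsw
          · exact hsr.trans hsw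
        have e2 : j = i.rev ↔ b = a.rev := by
          rcases c2 with ⟨rfl, rfl⟩ | ⟨rfl, rfl⟩ <;> grind [Fin.rev_rev]
        simp only [e1, e2, ← habs]
        ring
      · rw [if_neg c2, if_neg (show ¬(i = a ∧ j = b ∨ _) by tauto)]
        simp
  have h3 : (∑ p : Fin (2 * g) × Fin (2 * g),
      (if p ∈ ({(a, b), (b, a), (b.rev, a.rev), (a.rev, b.rev)} : Finset _) then
        (if b = a.rev then (2 : ℤ) else 1) else 0)) = 4 := by
    rw [← Finset.sum_filter, Finset.filter_mem_eq_inter, Finset.univ_inter, Finset.sum_const]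
    have hab := h.ne
    have ha := rev_ne a
    have hb := rev_ne b
    by_cases hba : b = a.rev
    · subst hba
      rw [Fin.rev_rev, if_pos rfl]
      have : ({(a, a.rev), (a.rev, a), (a, a.rev), (a.rev, a)} : Finset (Fin (2 * g) × Fin (2 * g)))
          = {(a, a.rev), (a.rev, a)} := by
        ext p
        simp only [Finset.mem_insert, Finset.mem_singleton]
        tauto
      rw [this, Finset.card_pair]
      · rfl
      · simp [ha]
    · rw [if_neg hba, Finset.card_insert_of_notMem, Finset.card_insert_of_notMem,
        Finset.card_pair]
      · rfl
      all_goals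
        simp only [Finset.mem_insert, Finset.mem_singleton, ne_eq, Prod.mk.injEq]
        grind [Fin.rev_rev]
  have h4 : wallSum (x * s) - wallSum x = 4 * (|t + 1| - |t|) := by
    rw [h1, wallSum, ← Finset.sum_sub_distrib, ← h3, Finset.sum_mul]
    exact Finset.sum_congr rfl fun p _ => h2 p
  linarith

theorem wallSum_mul_simpleReflection_of_neg {x : ExtAffWeyl g} {a b : Fin (2 * g)}
    (h : IsSimplePair a b) (hx : walls x a b < 0) :
    wallSum (x * simpleReflection a b) = wallSum x - 4 := by
  rw [wallSum_mul_simpleReflection x h, abs_of_neg hx, abs_of_nonpos (by omega)]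
  ring

theorem wallSum_mul_simpleReflection_le (x : ExtAffWeyl g) {a b : Fin (2 * g)}
    (h : IsSimplePair a b) : wallSum (x * simpleReflection a b) ≤ wallSum x + 4 := by
  rw [wallSum_mul_simpleReflection x h]
  have := abs_add_le (walls x a b) 1
  rw [abs_one] at this
  linarith

/-- An element of the affine Weyl group without descents is trivial. -/
theorem eq_one_of_walls_nonneg {x : ExtAffWeyl g} (hx : x ∈ affWeyl g)
    (h : ∀ a b, IsSimplePair a b → 0 ≤ walls x a b) : x = 1 := by
  rw [mem_affWeyl_iff] at hx
  -- Simple pairs reach only the middle; mirroring supplies the remaining adjacent pairs.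
  have hstep : ∀ a b : Fin (2 * g), (a : ℕ) + 1 = b → 0 ≤ walls x a b := by
    intro a b hab
    by_cases hb : (b : ℕ) ≤ g
    · exact h a b (.inl ⟨hab, hb⟩)
    · rw [← walls_rev]
      refine h _ _ (.inl ?_)
      simp only [Fin.val_rev]
      omega
  have hstep' : ∀ a b : Fin (2 * g), (a : ℕ) + 1 = b →
      offset x b ≤ offset x a ∧ (offset x b = offset x a → perm x a < perm x b) := by
    intro a b hab
    have h1 := hstep a b hab
    have h2 : ¬ b < a := by
      rw [Fin.lt_def]
      omega
    have h3 : perm x a ≠ perm x b := fun h => by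
      have := (perm x).injective h
      omega
    rw [walls, ltInd, ltInd, if_neg h2] at h1
    split_ifs at h1 with h4
    · constructor <;> intros <;> omega
    · exact ⟨by omega, fun _ => by omega⟩
  rcases Nat.eq_zero_or_pos g with rfl | hg
  · exact ext_of_perm_of_offset (fun i => i.elim0) (fun i => i.elim0)
  have hanti : ∀ k : ℕ, ∀ a b : Fin (2 * g), (a : ℕ) + k = b → offset x b ≤ offset x a := by
    intro k
    induction k with
    | zero =>
      intro a b hab
      rw [Fin.ext (by omega : (a : ℕ) = b)]
    | succ k ih =>
      intro a b hab
      have := b.isLt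
      refine ((hstep' ⟨a + k, by omega⟩ b (by dsimp only; omega)).1).trans (ih a _ rfl)
  -- The affine simple root bounds the total drop of the weakly decreasing offsets by 1. First and
  -- last offset are opposite, so the drop is even, hence zero, and all offsets vanish; then `w` is
  -- increasing.
  have hlast : offset x ⟨0, by omega⟩ ≤ offset x ⟨2 * g - 1, by omega⟩ + 1 := by
    have h1 := h ⟨2 * g - 1, by omega⟩ ⟨0, by omega⟩ (.inr ⟨by change 2 * g - 1 + 1 = 2 * g; omega, rfl⟩)
    have h2 : ltInd (⟨0, by omega⟩ : Fin (2 * g)) ⟨2 * g - 1, by omega⟩ = 1 :=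
      if_pos (by rw [Fin.lt_def]; change 0 < 2 * g - 1; omega)
    rw [walls, h2, ltInd] at h1
    split_ifs at h1 <;> omega
  have hsym := hx ⟨0, by omega⟩
  have hrev : Fin.rev (⟨0, by omega⟩ : Fin (2 * g)) = ⟨2 * g - 1, by omega⟩ := by
    ext
    simp [Fin.val_rev]
  rw [hrev] at hsym
  have hoff : ∀ a, offset x a = 0 := by
    intro a
    have ha := a.isLt
    have h1 := hanti a ⟨0, by omega⟩ a (by simp)
    have h2 := hanti (2 * g - 1 - a) a ⟨2 * g - 1, by omega⟩ (by dsimp only; omega)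
    have h3 := hanti (2 * g - 1) ⟨0, by omega⟩ ⟨2 * g - 1, by omega⟩ (by simp)
    omega
  have hmono : StrictMono (perm x) := by
    have key : ∀ k : ℕ, ∀ a b : Fin (2 * g), (a : ℕ) + k + 1 = b → perm x a < perm x b := by
      intro k
      induction k with
      | zero =>
        intro a b hab
        exact (hstep' a b hab).2 (by rw [hoff, hoff])
      | succ k ih =>
        intro a b hab
        have := b.isLt
        exact (ih a ⟨a + k + 1, by omega⟩ rfl).trans
          ((hstep' _ b (by dsimp only; omega)).2 (by rw [hoff, hoff]))
    intro a b hab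
    rw [Fin.lt_def] at hab
    exact key (b - a - 1) a b (by omega)
  have hid : ∀ i, perm x i = i := by
    have := Subsingleton.elim ((perm x).toOrderIso hmono.monotone
      (fun a b hab => by
        have := hmono.le_iff_le (a := (perm x).symm a) (b := (perm x).symm b)
        simpa [hab] using this)) (OrderIso.refl _)
    intro i
    exact congrArg (fun e : Fin (2 * g) ≃o Fin (2 * g) => e i) this
  exact ext_of_perm_of_offset hid hoff

/-! ### Coxeter length as a count of walls. -/

theorem mul_simpleReflection_cancel (x : ExtAffWeyl g) {a b : Fin (2 * g)}
    (h : IsSimplePair a b) : x * simpleReflection a b * simpleReflection a b = x := by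
  rw [mul_assoc, simpleReflection_mul_self h, mul_one]

/-- A nontrivial element has a descent, and removing it lowers the wall sum by exactly 4. -/
theorem exists_word {x : ExtAffWeyl g} (hx : x ∈ affWeyl g) :
    ∃ l : List (ExtAffWeyl g), (∀ s ∈ l, s ∈ simpleAffRefl g) ∧ l.prod = x ∧
      4 * (l.length : ℤ) = wallSum x := by
  induction hn : (wallSum x).toNat using Nat.strong_induction_on generalizing x with
  | _ n ih =>
  by_cases hone : x = 1
  · subst hone
    exact ⟨[], by simp, rfl, by simp [wallSum_one]⟩
  · obtain ⟨a, b, hab, hneg⟩ : ∃ a b, IsSimplePair a b ∧ walls x a b < 0 := by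
      by_contra! hcon
      exact hone (eq_one_of_walls_nonneg hx hcon)
    have h1 := wallSum_mul_simpleReflection_of_neg hab hneg
    have h2 := wallSum_nonneg (x * simpleReflection a b)
    obtain ⟨l, hl1, hl2, hl3⟩ := ih _ (by omega)
      (mul_mem_affWeyl hx (simpleReflection_mem_affWeyl hab)) rfl
    refine ⟨l ++ [simpleReflection a b], ?_, ?_, ?_⟩
    · intro s hs
      rw [List.mem_append, List.mem_singleton] at hs
      rcases hs with hs | rfl
      · exact hl1 s hs
      · exact mem_simpleAffRefl_iff.2 ⟨a, b, hab, rfl⟩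
    · rw [List.prod_append, List.prod_singleton, hl2, mul_simpleReflection_cancel x hab]
    · rw [List.length_append, List.length_singleton]
      push_cast
      linarith

theorem wallSum_prod_le (l : List (ExtAffWeyl g)) (hl : ∀ s ∈ l, s ∈ simpleAffRefl g) :
    wallSum l.prod ≤ 4 * (l.length : ℤ) := by
  induction l using List.reverseRecOn with
  | nil => simp [wallSum_one]
  | append_singleton l s ih =>
    obtain ⟨a, b, hab, rfl⟩ := mem_simpleAffRefl_iff.1 (hl s (by simp))
    have h1 := ih fun r hr => hl r (by simp [hr])
    have h2 := wallSum_mul_simpleReflection_le l.prod hab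
    rw [List.prod_append, List.prod_singleton, List.length_append, List.length_singleton]
    push_cast
    linarith

theorem four_mul_affLength {x : ExtAffWeyl g} (hx : x ∈ affWeyl g) :
    4 * (affLength x : ℤ) = wallSum x := by
  obtain ⟨l, hl1, hl2, hl3⟩ := exists_word hx
  have h1 : affLength x ≤ l.length := Nat.sInf_le ⟨l, hl1, hl2, rfl⟩
  obtain ⟨l', hl1', hl2', hl3'⟩ := Nat.sInf_mem (s := {n | ∃ l : List (ExtAffWeyl g),
    (∀ s ∈ l, s ∈ simpleAffRefl g) ∧ l.prod = x ∧ l.length = n}) ⟨_, l, hl1, hl2, rfl⟩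
  have h2 := wallSum_prod_le l' hl1'
  rw [hl2', hl3'] at h2
  change wallSum x ≤ 4 * (affLength x : ℤ) at h2
  omega

theorem affLength_le_of_prod {l : List (ExtAffWeyl g)} (hl : ∀ s ∈ l, s ∈ simpleAffRefl g) :
    affLength l.prod ≤ l.length :=
  Nat.sInf_le ⟨l, hl, rfl, rfl⟩

/-! ### The stabilizer of the base alcove -/

theorem walls_eq_zero_of_mem_Omega {c : ExtAffWeyl g} (hc : c ∈ Omega g) (i j : Fin (2 * g)) :
    walls c i j = 0 := by
  have hg : (0 : ℝ) < 2 * g := by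
    have := i.isLt
    exact_mod_cast (by omega : 0 < 2 * g)
  -- One test point of the alcove suffices: its coordinates are so evenly spaced that the alcove
  -- inequalities for its image determine all offset differences.
  have hmem : (fun k : Fin (2 * g) => ((k : ℕ) : ℝ) / (2 * g)) ∈ baseAlcove g := by
    constructor
    · intro k l
      have h : ∀ k : Fin (2 * g), ((k.rev : ℕ) : ℝ) = 2 * g - 1 - (k : ℕ) := by
        intro k
        rw [Fin.val_rev, Nat.cast_sub (by have := k.isLt; omega)]
        push_cast
        ring
      simp only [h]
      ring
    · intro k l hkl
      have h1 : ((k : ℕ) : ℝ) < (l : ℕ) := by exact_mod_cast hkl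
      have h2 : ((l : ℕ) : ℝ) < 2 * g := by exact_mod_cast l.isLt
      have h3 : (0 : ℝ) ≤ (k : ℕ) := Nat.cast_nonneg _
      rw [← sub_div, lt_div_iff₀ hg, div_lt_iff₀ hg]
      constructor <;> linarith
  have himg : act c _ ∈ baseAlcove g := (Set.ext_iff.1 hc _).1 ⟨_, hmem, rfl⟩
  have key : ∀ k l : Fin (2 * g), perm c k < perm c l → walls c k l = 0 := by
    intro k l hkl
    have h1 := himg.2 _ _ hkl
    have hact : ∀ k : Fin (2 * g), act c (fun k : Fin (2 * g) => ((k : ℕ) : ℝ) / (2 * g)) (perm c k)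
        = ((k : ℕ) : ℝ) / (2 * g) + offset c k := by
      intro k
      change (((perm c).symm (perm c k) : ℕ) : ℝ) / _ + _ = _
      rw [Equiv.symm_apply_apply]
      rfl
    rw [hact, hact] at h1
    have h2 : -(2 * g : ℝ) < ((k : ℕ) : ℝ) - (l : ℕ) + 2 * g * (offset c k - offset c l) ∧
        ((k : ℕ) : ℝ) - (l : ℕ) + 2 * g * (offset c k - offset c l) < 0 := by
      have h3 : ((k : ℕ) : ℝ) - (l : ℕ) + 2 * g * (offset c k - offset c l) = 2 * g *
          (((k : ℕ) : ℝ) / (2 * g) + offset c k - (((l : ℕ) : ℝ) / (2 * g) + offset c l)) := by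
        have hcan : ∀ r : ℝ, 2 * (g : ℝ) * (r / (2 * g)) = r := fun r => mul_div_cancel₀ r hg.ne'
        linear_combination hcan (l : ℕ) - hcan (k : ℕ)
      rw [h3]
      constructor <;> nlinarith [h1.1, h1.2]
    have h4 : -(2 * g : ℤ) < ((k : ℕ) : ℤ) - (l : ℕ) + 2 * g * (offset c k - offset c l) ∧
        ((k : ℕ) : ℤ) - (l : ℕ) + 2 * g * (offset c k - offset c l) < 0 := by
      exact_mod_cast h2
    have hk := k.isLt
    have hl := l.isLt
    -- Difference 0 forces k < l and difference −1 forces l < k; the order indicators cancel the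
    -- difference in both cases.
    have h5 : offset c k - offset c l = 0 ∨ offset c k - offset c l = -1 := by
      have hup : offset c k - offset c l < 1 := by
        by_contra! hcon
        nlinarith [h4.2]
      have hlow : -2 < offset c k - offset c l := by
        by_contra! hcon
        nlinarith [h4.1]
      omega
    rw [walls, ltInd, ltInd, if_neg (not_lt.2 hkl.le)]
    rcases h5 with h5 | h5 <;> rw [h5] at h4 ⊢
    · rw [if_neg (by rw [Fin.lt_def]; omega)]
      rfl
    · rw [if_pos (by rw [Fin.lt_def]; omega)]
      rfl
  rcases lt_trichotomy (perm c i) (perm c j) with h | h | h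
  · exact key i j h
  · rw [(perm c).injective h, walls_self]
  · rw [walls_swap, key j i h, neg_zero]

/-- The infimum defining `length` is attained by some factorisation, and every factorisation gives
the same value because the wall sum ignores left factors from Ω. The given one shows the set
nonempty, which excludes the default value 0. -/
theorem four_mul_length {c w : ExtAffWeyl g} (hc : c ∈ Omega g) (hw : w ∈ affWeyl g) :
    4 * (length (c * w) : ℤ) = wallSum (c * w) := by
  obtain ⟨c', hc', w', hw', h1, h2⟩ := Nat.sInf_mem (s := {n | ∃ c' ∈ Omega g, ∃ w' ∈ affWeyl g,
    c * w = c' * w' ∧ n = affLength w'}) ⟨_, c, hc, w, hw, rfl, rfl⟩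
  rw [h1, wallSum_mul_of_walls_eq_zero (walls_eq_zero_of_mem_Omega hc'),
    ← four_mul_affLength hw', ← h2, ← h1]
  rfl

/-! ### Reflections and length -/

/-- If an element of the affine Weyl group makes a positive affine root `(i, j, q)` negative, then
the corresponding reflection shortens it. -/
theorem exists_shorter_word (l : List (ExtAffWeyl g)) (hl : ∀ s ∈ l, s ∈ simpleAffRefl g)
    {i j : Fin (2 * g)} (hij : i ≠ j) {q : ℤ} (hpos : ltInd j i ≤ q)
    (hneg : q - ltInd j i + walls l.prod i j < 0) :
    ∃ l' : List (ExtAffWeyl g), (∀ s ∈ l', s ∈ simpleAffRefl g) ∧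
      l'.prod = l.prod * affReflection i j q ∧ l'.length < l.length := by
  induction l using List.reverseRecOn generalizing i j q with
  | nil =>
    rw [List.prod_nil, walls_one] at hneg
    omega
  | append_singleton l s ih =>
    have hs := hl s (by simp)
    have hl' : ∀ r ∈ l, r ∈ simpleAffRefl g := fun r hr => hl r (by simp [hr])
    obtain ⟨a, b, hab, rfl⟩ := mem_simpleAffRefl_iff.1 hs
    set s := simpleReflection a b with hsdef
    rw [List.prod_append, List.prod_singleton] at hneg ⊢
    rw [walls_mul] at hneg
    -- This is the strong exchange condition. The word is read from the right: the letter that makes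
    -- the root negative is the one to delete. A positive root made negative by the simple
    -- reflection `s` is the root of `s`.
    by_cases hsneg : q - ltInd j i + walls s i j < 0
    · refine ⟨l, hl', ?_, by simp⟩
      have hr : affReflection i j q = s := by
        rw [hsdef, walls_simpleReflection hab] at hsneg
        split_ifs at hsneg with h1 h2
        · have hq : q = ltInd j i := by omega
          rcases h1 with ⟨rfl, rfl⟩ | ⟨rfl, rfl⟩
          · rw [hq]
            rfl
          · rw [hq, affReflection_rev hab.ne]
            simp only [ltInd, Fin.rev_lt_rev]
            rfl
        · omega
        · omega
      rw [hr, mul_simpleReflection_cancel _ hab]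
    · have hw : q + offset s i - offset s j - ltInd (perm s j) (perm s i) =
          q - ltInd j i + walls s i j := by
        simp only [walls]
        ring
      -- Otherwise the root is moved by `s`, remains positive, and must be made negative by the rest
      -- of the word.
      obtain ⟨l', h1, h2, h3⟩ := ih hl' (i := perm s i) (j := perm s j)
        (q := q + offset s i - offset s j) (fun h => hij ((perm s).injective h)) (by omega)
        (by omega)
      refine ⟨l' ++ [s], ?_, ?_, by simpa using h3⟩
      · intro r hr
        rw [List.mem_append, List.mem_singleton] at hr
        rcases hr with hr | rfl
        · exact h1 r hr
        · exact hs
      · rw [List.prod_append, List.prod_singleton, h2, mul_assoc, mul_assoc,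
          mul_affReflection s hij]

theorem affLength_mul_affReflection_lt {x : ExtAffWeyl g} (hx : x ∈ affWeyl g)
    {i j : Fin (2 * g)} (hij : i ≠ j) {q : ℤ} (hpos : ltInd j i ≤ q)
    (hneg : q - ltInd j i + walls x i j < 0) :
    affLength (x * affReflection i j q) < affLength x := by
  obtain ⟨l, hl1, rfl, hl3⟩ := exists_word hx
  obtain ⟨l', h1, h2, h3⟩ := exists_shorter_word l hl1 hij hpos hneg
  rw [← h2]
  have h4 := affLength_le_of_prod h1
  have h5 := four_mul_affLength hx
  omega

/-- The inequality on q expresses positivity of the affine root; of (i, j, q) and (j, i, −q) one is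
positive, and both give the same reflection. -/
theorem exists_affReflection_of_mem_affRefl {r : ExtAffWeyl g} (hr : r ∈ affRefl g) :
    ∃ i j q, i ≠ j ∧ ltInd j i ≤ q ∧ r = affReflection i j q := by
  obtain ⟨z, -, s, hs, rfl⟩ := hr
  obtain ⟨a, b, hab, rfl⟩ := mem_simpleAffRefl_iff.1 hs
  have h : ∃ i j q, i ≠ j ∧ z * simpleReflection a b * z⁻¹ = affReflection i j q := by
    refine ⟨_, _, (if b < a then 1 else 0) + offset z a - offset z b, fun h => hab.ne ((perm z).injective h), ?_⟩
    rw [simpleReflection, mul_affReflection z hab.ne, mul_inv_cancel_right]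
  obtain ⟨i, j, q, hij, h⟩ := h
  by_cases hq : ltInd j i ≤ q
  · exact ⟨i, j, q, hij, hq, h⟩
  · refine ⟨j, i, -q, hij.symm, ?_, by rw [h, affReflection_swap hij]⟩
    simp only [ltInd] at hq ⊢
    grind

/-! ### Admissible elements are permissible -/

/-- The vertexwise permissibility condition for the minuscule cocharacter `μ`. -/
def IsPermissible (x : ExtAffWeyl g) : Prop :=
  (∀ i, offset x i + offset x i.rev = 1) ∧
    ∀ i, (offset x i = 0 ∧ perm x i ≤ i) ∨ (offset x i = 1 ∧ i ≤ perm x i)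

/-- View x as the 2g-periodic permutation f(i) = w(i) − 2g·offset(i) of ℤ; the second condition says
i − 2g ≤ f(i) ≤ i. The hypotheses say that i < j' = j + 2gq and f(i) > f(j'). Exchanging these two
values keeps the bounds, since j' − 2g ≤ f(j') < f(i) ≤ i < j'. -/
theorem IsPermissible.mul_affReflection {x : ExtAffWeyl g} (hx : IsPermissible x)
    {i j : Fin (2 * g)} (hij : i ≠ j) {q : ℤ} (hpos : ltInd j i ≤ q)
    (hneg : q - ltInd j i + walls x i j < 0) : IsPermissible (x * affReflection i j q) := by
  have h1 := rev_ne i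
  have h2 := rev_ne j
  have hmem := mem_affWeyl_iff.1 (affReflection_mem_affWeyl hij q)
  have hmult : ∀ k, offset (x * affReflection i j q) k +
      offset (x * affReflection i j q) k.rev = 1 := by
    intro k
    have h3 := hx.1 (perm (affReflection i j q) k)
    have h4 := hmem k
    rw [offset_mul, offset_mul, perm_rev]
    omega
  have hrev : ∀ k, ((offset (x * affReflection i j q) k = 0 ∧
        perm (x * affReflection i j q) k ≤ k) ∨
        (offset (x * affReflection i j q) k = 1 ∧ k ≤ perm (x * affReflection i j q) k)) →
      ((offset (x * affReflection i j q) k.rev = 0 ∧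
        perm (x * affReflection i j q) k.rev ≤ k.rev) ∨
        (offset (x * affReflection i j q) k.rev = 1 ∧
          k.rev ≤ perm (x * affReflection i j q) k.rev)) := by
    intro k hk
    have h3 := hmult k
    rw [perm_rev, Fin.rev_le_rev, Fin.rev_le_rev]
    rcases hk with hk | hk
    · exact .inr ⟨by omega, hk.2⟩
    · exact .inl ⟨by omega, hk.2⟩
  have hi := hx.2 i
  have hj := hx.2 j
  simp only [walls, ltInd, Fin.lt_def] at hneg hpos
  rw [Fin.le_def, Fin.le_def] at hi hj
  have hneij : (i : ℕ) ≠ j := fun h => hij (Fin.ext h)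
  have hwij : (perm x i : ℕ) ≠ perm x j := fun h => hij ((perm x).injective (Fin.ext h))
  have casei : (offset (x * affReflection i j q) i = 0 ∧
        perm (x * affReflection i j q) i ≤ i) ∨
        (offset (x * affReflection i j q) i = 1 ∧ i ≤ perm (x * affReflection i j q) i) := by
    rw [offset_mul, perm_mul_apply, perm_affReflection, offset_affReflection hij, if_pos rfl,
      if_pos rfl, Fin.le_def, Fin.le_def]
    split_ifs at hneg hpos <;> omega
  have casej : (offset (x * affReflection i j q) j = 0 ∧
        perm (x * affReflection i j q) j ≤ j) ∨
        (offset (x * affReflection i j q) j = 1 ∧ j ≤ perm (x * affReflection i j q) j) := by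
    rw [offset_mul, perm_mul_apply, perm_affReflection, offset_affReflection hij, if_neg hij.symm,
      if_neg hij.symm, if_pos rfl, if_pos rfl, Fin.le_def, Fin.le_def]
    split_ifs at hneg hpos <;> omega
  refine ⟨hmult, fun k => ?_⟩
  by_cases hki : k = i
  · rw [hki]
    exact casei
  by_cases hkj : k = j
  · rw [hkj]
    exact casej
  by_cases hki' : k = i.rev
  · rw [hki']
    exact hrev i casei
  by_cases hkj' : k = j.rev
  · rw [hkj']
    exact hrev j casej
  have h3 : perm (affReflection i j q) k = k := by
    rw [perm_affReflection, if_neg hki, if_neg hkj, if_neg hki', if_neg hkj']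
  have h4 : offset (affReflection i j q) k = 0 := by
    rw [offset_affReflection hij, if_neg hki, if_neg hkj, if_neg hki', if_neg hkj']
  rw [offset_mul, perm_mul_apply, h3, h4, add_zero]
  exact hx.2 k

theorem isPermissible_trans_mu (w : weyl g) : IsPermissible (trans (weylActFun w (mu g))) := by
  have h01 : ∀ i, (mu g).1 i = 0 ∨ (mu g).1 i = 1 := by
    intro i
    simp only [mu]
    split_ifs <;> simp
  have hsum : ∀ i, (mu g).1 i + (mu g).1 i.rev = 1 := by
    intro i
    have := i.isLt
    simp only [mu, Fin.val_rev]
    split_ifs <;> omega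
  constructor
  · intro i
    rw [offset_trans, offset_trans]
    have h := mem_weyl_iff.1 (w⁻¹ : weyl g).2 i
    change (mu g).1 ((w⁻¹ : weyl g).1 i) + (mu g).1 ((w⁻¹ : weyl g).1 i.rev) = 1
    rw [h]
    exact hsum _
  · intro i
    rw [offset_trans, perm_trans]
    rcases h01 ((w⁻¹ : weyl g).1 i) with h | h
    · exact .inl ⟨h, le_rfl⟩
    · exact .inr ⟨h, le_rfl⟩

/-- Translations t^{wμ} are permissible, and permissibility passes down each step of a Bruhat chain.
-/
theorem isPermissible_of_mem_adm {x : ExtAffWeyl g} (hx : x ∈ adm g) : IsPermissible x := by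
  obtain ⟨u, c, hc, w, -, w', hw', rfl, h2, h3⟩ := hx
  have hc0 := walls_eq_zero_of_mem_Omega hc
  have key : w ∈ affWeyl g ∧ IsPermissible (c * w) := by
    induction h3 using Relation.ReflTransGen.head_induction_on with
    | refl => exact ⟨hw', h2 ▸ isPermissible_trans_mu u⟩
    | @head a b hab _ ih =>
      obtain ⟨⟨r, hr, rfl⟩, hlt⟩ := hab
      obtain ⟨i, j, q, hij, hpos, rfl⟩ := exists_affReflection_of_mem_affRefl hr
      have hcancel : a * affReflection i j q * affReflection i j q = a := by
        rw [mul_assoc, affReflection_mul_self hij, mul_one]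
      have ha : a ∈ affWeyl g := by
        rw [← hcancel]
        exact mul_mem_affWeyl ih.1 (affReflection_mem_affWeyl hij q)
      refine ⟨ha, ?_⟩
      -- By the exchange condition the shorter element `a` keeps the root positive; hence the longer
      -- one makes it negative, as the descent lemma requires.
      have hnonneg : 0 ≤ q - ltInd j i + walls a i j := by
        by_contra! hcon
        exact absurd (affLength_mul_affReflection_lt ha hij hpos hcon) (by omega)
      have hr1 : perm (affReflection i j q) i = j := by
        rw [perm_affReflection, if_pos rfl]
      have hr2 : perm (affReflection i j q) j = i := by
        rw [perm_affReflection, if_neg hij.symm, if_pos rfl]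
      have hneg : q - ltInd j i + walls (c * (a * affReflection i j q)) i j < 0 := by
        rw [walls_mul, hc0, zero_add, walls_mul, hr1, hr2, walls_swap]
        have hnij : (i : ℕ) ≠ j := fun h => hij (Fin.ext h)
        have hwij : (perm a i : ℕ) ≠ perm a j := fun h => hij ((perm a).injective (Fin.ext h))
        have ho1 : offset (affReflection i j q) i = -q := by
          rw [offset_affReflection hij, if_pos rfl]
        have ho2 : offset (affReflection i j q) j = q := by
          rw [offset_affReflection hij, if_neg hij.symm, if_pos rfl]
        simp only [walls, hr1, hr2, ho1, ho2, ltInd, Fin.lt_def] at hnonneg ⊢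
        split_ifs at hnonneg ⊢ <;> omega
      have := ih.2.mul_affReflection hij hpos hneg
      rwa [mul_assoc, hcancel] at this
  exact key.2

theorem four_mul_length_of_mem_adm {x : ExtAffWeyl g} (hx : x ∈ adm g) :
    4 * (length x : ℤ) = wallSum x := by
  obtain ⟨u, c, hc, w, hw, w', -, rfl, -, -⟩ := hx
  exact four_mul_length hc hw

/-! ### Inversions and crossings of permutations -/

section Permutations

variable {n : ℕ} (w : Equiv.Perm (Fin n))

/-- A bijection moves as many points up across a cut as down across it. -/
theorem sum_upward_eq_sum_downward (e : Fin n) :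
    (∑ k, if k < e ∧ e ≤ w k then (1 : ℤ) else 0) = ∑ k, if w k < e ∧ e ≤ k then 1 else 0 := by
  have h : (∑ k, if w k < e then (1 : ℤ) else 0) = ∑ k, if k < e then 1 else 0 :=
    Equiv.sum_comp w fun k => if k < e then (1 : ℤ) else 0
  have h' : ((∑ k, if k < e ∧ e ≤ w k then (1 : ℤ) else 0) -
      ∑ k, if w k < e ∧ e ≤ k then 1 else 0) =
      (∑ k, if k < e then 1 else 0) - ∑ k, if w k < e then (1 : ℤ) else 0 := by
    rw [← Finset.sum_sub_distrib, ← Finset.sum_sub_distrib]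
    refine Finset.sum_congr rfl fun k _ => ?_
    simp only [← not_lt]
    by_cases h1 : k < e <;> by_cases h2 : w k < e <;> simp [h1, h2]
  linarith

theorem crossings_eq_sum :
    (crossings w : ℤ) = ∑ i, ∑ j, if i < j ∧ j < w i ∧ w i < w j then 1 else 0 := by
  rw [crossings, Finset.card_filter, Fintype.sum_prod_type]
  push_cast
  rfl

theorem crossings_inv_eq_sum :
    (crossings w⁻¹ : ℤ) = ∑ i, ∑ j, if w i < w j ∧ w j < i ∧ i < j then 1 else 0 := by
  rw [crossings_eq_sum, ← Equiv.sum_comp w]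
  refine Finset.sum_congr rfl fun i _ => ?_
  rw [← Equiv.sum_comp w]
  have h : ∀ k, w⁻¹ (w k) = k := w.symm_apply_apply
  simp only [h]

/-- Counting inversions of a permutation according to the type (weak excedance or weak
anti-excedance) of the two positions involved. -/
theorem sum_inversions (U : Fin n → Prop) [DecidablePred U] (hU : ∀ i, U i → i ≤ w i)
    (hU' : ∀ i, ¬ U i → w i ≤ i) :
    (∑ i, ∑ j, if U i ∧ ¬ U j ∧ i < j ∧ w j < w i then (1 : ℤ) else 0) =
      (∑ i, ∑ j, if U i ∧ U j ∧ i < j ∧ w j < w i then 1 else 0) +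
      (∑ i, ∑ j, if ¬ U i ∧ ¬ U j ∧ i < j ∧ w j < w i then 1 else 0) +
      crossings w + crossings w⁻¹ + (∑ i, if w i ≠ i then 1 else 0) -
      ∑ j, if w⁻¹ j < j ∧ w j < j then 1 else 0 := by
  have hinj : ∀ i j, w i = w j ↔ i = j := fun i j => w.injective.eq_iff
  -- Mixed inversions (i, j) are split by j < w(i) or w(i) ≤ j. The latter j move down across the
  -- cut at w(i), so they are as many as the k with k < w(i) ≤ w(k): these are i itself if i < w(i),
  -- the inversions (k, i) inside U, and the crossings (i, k).
  have step1 : ∀ i, (∑ j, if U i ∧ ¬ U j ∧ i < j ∧ w j < w i then (1 : ℤ) else 0) =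
      (∑ j, if U i ∧ ¬ U j ∧ i < j ∧ j < w i then 1 else 0) + (if i < w i then 1 else 0) +
      (∑ k, if U k ∧ U i ∧ k < i ∧ w i < w k then 1 else 0) +
      (∑ k, if i < k ∧ k < w i ∧ w i < w k then 1 else 0) := by
    intro i
    by_cases hi : U i
    · have h1 := hU i hi
      have h2 : (∑ j, if U i ∧ ¬ U j ∧ i < j ∧ w j < w i then (1 : ℤ) else 0) =
          (∑ j, if U i ∧ ¬ U j ∧ i < j ∧ j < w i then 1 else 0) +
          ∑ j, if w j < w i ∧ w i ≤ j then 1 else 0 := by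
        rw [← Finset.sum_add_distrib]
        refine Finset.sum_congr rfl fun j _ => ?_
        have h3 := hU j
        have h4 := hU' j
        have h5 := hinj i j
        grind
      have h6 : (if i < w i then (1 : ℤ) else 0) = ∑ k, if k = i ∧ i < w i then 1 else 0 := by
        simp [ite_and]
      have h7 : (∑ k, if k < w i ∧ w i ≤ w k then (1 : ℤ) else 0) =
          (∑ k, if k = i ∧ i < w i then 1 else 0) +
          (∑ k, if U k ∧ U i ∧ k < i ∧ w i < w k then 1 else 0) +
          ∑ k, if i < k ∧ k < w i ∧ w i < w k then 1 else 0 := by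
        rw [← Finset.sum_add_distrib, ← Finset.sum_add_distrib]
        refine Finset.sum_congr rfl fun k _ => ?_
        have h3 := hU k
        have h4 := hU' k
        have h5 := hinj i k
        grind
      have h8 := sum_upward_eq_sum_downward w (w i)
      linarith
    · have h1 := hU' i hi
      have h2 : ∀ k, ¬ (i < k ∧ k < w i ∧ w i < w k) := fun k hk =>
        absurd (hk.1.trans hk.2.1) (not_lt.2 h1)
      simp [hi, h2, not_lt.2 h1]
  -- The remaining pairs are balanced across the cut at j. The strict inequality j < w(i) omits i =
  -- w⁻¹(j), which accounts for the subtracted peak term.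
  have step2 : ∀ j, (∑ i, if U i ∧ ¬ U j ∧ i < j ∧ j < w i then (1 : ℤ) else 0) =
      (if w j < j then 1 else 0) - (if w⁻¹ j < j ∧ w j < j then 1 else 0) +
      (∑ l, if ¬ U j ∧ ¬ U l ∧ j < l ∧ w l < w j then 1 else 0) +
      ∑ l, if w j < w l ∧ w l < j ∧ j < l then 1 else 0 := by
    intro j
    have hw : w (w⁻¹ j) = j := w.apply_symm_apply j
    by_cases hj : U j
    · have h1 := hU j hj
      have h2 : ∀ l, ¬ (w j < w l ∧ w l < j ∧ j < l) := fun k hk =>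
        absurd (hk.1.trans hk.2.1) (not_lt.2 h1)
      simp [hj, h2, not_lt.2 h1]
    · have h1 := hU' j hj
      have h2 : (∑ i, if i < j ∧ j ≤ w i then (1 : ℤ) else 0) =
          (∑ i, if U i ∧ ¬ U j ∧ i < j ∧ j < w i then (1 : ℤ) else 0) +
          ∑ i, if i = w⁻¹ j ∧ w⁻¹ j < j ∧ w j < j then 1 else 0 := by
        rw [← Finset.sum_add_distrib]
        refine Finset.sum_congr rfl fun i _ => ?_
        have h3 := hU i
        have h4 := hU' i
        have h5 := hinj i (w⁻¹ j)
        have h6 := hinj j (w⁻¹ j)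
        rw [hw] at h5 h6
        grind
      have h3 : (∑ l, if w l < j ∧ j ≤ l then (1 : ℤ) else 0) =
          (∑ l, if l = j ∧ w j < j then 1 else 0) +
          (∑ l, if ¬ U j ∧ ¬ U l ∧ j < l ∧ w l < w j then 1 else 0) +
          ∑ l, if w j < w l ∧ w l < j ∧ j < l then 1 else 0 := by
        rw [← Finset.sum_add_distrib, ← Finset.sum_add_distrib]
        refine Finset.sum_congr rfl fun l _ => ?_
        have h3 := hU l
        have h4 := hU' l
        have h5 := hinj l j
        grind
      have h6 : (∑ i, if i = w⁻¹ j ∧ w⁻¹ j < j ∧ w j < j then (1 : ℤ) else 0) =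
          if w⁻¹ j < j ∧ w j < j then 1 else 0 := by
        simp only [ite_and, Finset.sum_ite_eq', Finset.mem_univ, if_true]
      have h7 : (∑ l, if l = j ∧ w j < j then (1 : ℤ) else 0) = if w j < j then 1 else 0 := by
        simp only [ite_and, Finset.sum_ite_eq', Finset.mem_univ, if_true]
      have h8 := sum_upward_eq_sum_downward w j
      rw [h2, h3, h6, h7] at h8
      linarith
  have hm : (∑ i, if w i ≠ i then (1 : ℤ) else 0) =
      (∑ i, if i < w i then 1 else 0) + ∑ i, if w i < i then 1 else 0 := by
    rw [← Finset.sum_add_distrib]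
    refine Finset.sum_congr rfl fun i _ => ?_
    rcases lt_trichotomy (w i) i with h | h | h
    · simp [h, h.ne, h.le]
    · simp [h]
    · simp [h, h.ne', h.le]
  rw [Finset.sum_congr rfl fun i _ => step1 i]
  simp only [Finset.sum_add_distrib]
  rw [Finset.sum_comm (f := fun i j => if U i ∧ ¬ U j ∧ i < j ∧ j < w i then (1 : ℤ) else 0),
    Finset.sum_congr rfl fun j _ => step2 j]
  simp only [Finset.sum_add_distrib, Finset.sum_sub_distrib]
  rw [Finset.sum_comm (f := fun i k => if U k ∧ U i ∧ k < i ∧ w i < w k then (1 : ℤ) else 0),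
    crossings_eq_sum, crossings_inv_eq_sum, hm]
  ring

/-- The number of double ascents and double descents of a permutation. -/
def doubles : ℕ :=
  Finset.card {j : Fin n | (w⁻¹ j < j ∧ j < w j) ∨ (w j < j ∧ j < w⁻¹ j)}

/-- A moved point is a peak, a valley or a double point of its cycle. Peaks and valleys are equally
many because as many points are left by a downward arrow as are entered by one. -/
theorem sum_ne_eq_two_mul_peaks_add_doubles :
    (∑ i, if w i ≠ i then (1 : ℤ) else 0) =
      2 * (∑ j, if w⁻¹ j < j ∧ w j < j then 1 else 0) + doubles w := by
  have h1 : (∑ j, if w j < j then (1 : ℤ) else 0) = ∑ j, if j < w⁻¹ j then 1 else 0 := by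
    rw [← Equiv.sum_comp w fun j => if j < w⁻¹ j then (1 : ℤ) else 0]
    have h : ∀ k, w⁻¹ (w k) = k := w.symm_apply_apply
    simp only [h]
  have h2 : (∑ i, if w i ≠ i then (1 : ℤ) else 0) -
      (2 * (∑ j, if w⁻¹ j < j ∧ w j < j then 1 else 0) + doubles w) =
      (∑ j, if j < w⁻¹ j then 1 else 0) - ∑ j, if w j < j then (1 : ℤ) else 0 := by
    rw [doubles, Finset.card_filter, Finset.mul_sum]
    push_cast
    rw [← Finset.sum_add_distrib, ← Finset.sum_sub_distrib, ← Finset.sum_sub_distrib]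
    refine Finset.sum_congr rfl fun j _ => ?_
    have h3 : w⁻¹ j = j ↔ w j = j := by
      rw [Equiv.Perm.inv_eq_iff_eq, eq_comm]
    grind
  rw [h1, sub_self] at h2
  linarith

end Permutations

/-! ### The length of a permissible element -/

/-- The number of points moved by a permutation from one half of `{1, …, 2g}` to the other. -/
def flips (w : Equiv.Perm (Fin (2 * g))) : ℕ :=
  Finset.card {i : Fin (2 * g) | ¬ (i < i.rev ↔ w i < (w i).rev)}

theorem sum_offset_eq_one {x : ExtAffWeyl g} (hx : IsPermissible x) :
    (∑ i, if offset x i = 1 then (1 : ℤ) else 0) = g ∧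
      (∑ i, if ¬ offset x i = 1 then (1 : ℤ) else 0) = g := by
  have h1 : (∑ i, if ¬ offset x i = 1 then (1 : ℤ) else 0) =
      ∑ i, if offset x i = 1 then (1 : ℤ) else 0 := by
    rw [← Equiv.sum_comp Fin.revPerm]
    refine Finset.sum_congr rfl fun i _ => ?_
    have h2 := hx.1 i
    have h3 := hx.2 i
    rw [Fin.revPerm_apply]
    refine if_congr ?_ rfl rfl
    omega
  have h2 : (∑ i, if offset x i = 1 then (1 : ℤ) else 0) +
      (∑ i, if ¬ offset x i = 1 then (1 : ℤ) else 0) = 2 * g := by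
    rw [← Finset.sum_add_distrib, Finset.sum_congr rfl fun i _ =>
      show _ = (1 : ℤ) by by_cases h : offset x i = 1 <;> simp [h]]
    simp
  constructor <;> linarith

/-- Up to the antidiagonal term, the sum is twice a count over i < j: g² pairs of different offset,
plus inversions between equal offsets, minus mixed ones. `sum_inversions` evaluates their
difference. -/
theorem wallSum_of_isPermissible {x : ExtAffWeyl g} (hx : IsPermissible x) :
    wallSum x + 2 * crossings (perm x) + 2 * crossings (perm x)⁻¹ + flips (perm x) +
      doubles (perm x) + (∑ i, if perm x i ≠ i then (1 : ℤ) else 0) = 2 * (g : ℤ) ^ 2 + 2 * g := by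
  set w := perm x with hw
  have hinj : ∀ i j, w i = w j ↔ i = j := fun i j => w.injective.eq_iff
  have h1 : wallSum x = (∑ i, ∑ j, |walls x i j|) + ∑ i : Fin (2 * g), |walls x i i.rev| := by
    rw [wallSum, Fintype.sum_prod_type, ← Finset.sum_add_distrib]
    refine Finset.sum_congr rfl fun i _ => ?_
    rw [← sub_eq_iff_eq_add', ← Finset.sum_sub_distrib, Finset.sum_eq_single i.rev]
    · simp
      ring
    · intro j _ hj
      simp [hj]
    · simp
  -- Offsets of mirror points differ by ±1; the order indicators cancel this exactly when i changes
  -- halves.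
  have h2 : (∑ i : Fin (2 * g), |walls x i i.rev|) = 2 * g - flips w := by
    have h3 : (2 * g : ℤ) = ∑ i : Fin (2 * g), 1 := by simp
    rw [flips, Finset.card_filter, h3]
    push_cast
    rw [← Finset.sum_sub_distrib]
    refine Finset.sum_congr rfl fun i _ => ?_
    have h4 := hx.1 i
    have h5 := hx.2 i
    have h6 := rev_ne i
    have hi := i.isLt
    have hwi := (w i).isLt
    have hwr : w i.rev = (w i).rev := perm_rev x i
    simp only [walls, ltInd, ← hw, hwr, Fin.lt_def, Fin.le_def, Fin.val_rev] at h5 ⊢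
    rcases h5 with h5 | h5
    · rw [show offset x i - offset x i.rev = -1 by omega]
      by_cases c1 : (i : ℕ) < 2 * g - (i + 1)
      · rw [if_neg (by omega), if_neg (by omega), if_neg (not_not.2 (by omega))]
        norm_num
      · rw [if_pos (show 2 * g - ((i : ℕ) + 1) < i by omega)]
        split_ifs <;> first | (exfalso; omega) | norm_num
    · rw [show offset x i - offset x i.rev = 1 by omega]
      by_cases c1 : (i : ℕ) < 2 * g - (i + 1)
      · rw [if_neg (show ¬ 2 * g - ((i : ℕ) + 1) < i by omega)]
        split_ifs <;> first | (exfalso; omega) | norm_num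
      · rw [if_pos (by omega), if_pos (by omega), if_neg (not_not.2 (by omega))]
        norm_num
  have h3 : (∑ i, ∑ j, |walls x i j|) = 2 * ∑ i, ∑ j, if i < j then |walls x i j| else 0 := by
    have h4 : (∑ i, ∑ j, if i < j then |walls x i j| else 0) =
        ∑ i, ∑ j, if j < i then |walls x i j| else 0 := by
      rw [Finset.sum_comm]
      refine Finset.sum_congr rfl fun i _ => Finset.sum_congr rfl fun j _ => ?_
      rw [walls_swap, abs_neg]
    have h5 : (∑ i, ∑ j, |walls x i j|) = (∑ i, ∑ j, if i < j then |walls x i j| else 0) +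
        ∑ i, ∑ j, if j < i then |walls x i j| else 0 := by
      rw [← Finset.sum_add_distrib]
      refine Finset.sum_congr rfl fun i _ => ?_
      rw [← Finset.sum_add_distrib]
      refine Finset.sum_congr rfl fun j _ => ?_
      rcases lt_trichotomy i j with h | rfl | h
      · simp [h, h.le]
      · simp [walls_self]
      · simp [h, h.le]
    linarith
  have h4 : (∑ i, ∑ j, if i < j then |walls x i j| else 0) =
      (∑ i, ∑ j, if offset x i = 1 ∧ offset x j = 1 ∧ i < j ∧ w j < w i then 1 else 0) +
      (∑ i, ∑ j, if ¬ offset x i = 1 ∧ ¬ offset x j = 1 ∧ i < j ∧ w j < w i then 1 else 0) -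
      (∑ i, ∑ j, if offset x i = 1 ∧ ¬ offset x j = 1 ∧ i < j ∧ w j < w i then 1 else 0) +
      (∑ i, ∑ j, if offset x i = 1 ∧ ¬ offset x j = 1 ∧ i < j then 1 else 0) +
      ∑ i, ∑ j, if offset x j = 1 ∧ ¬ offset x i = 1 ∧ i < j then 1 else 0 := by
    simp only [← Finset.sum_add_distrib, ← Finset.sum_sub_distrib]
    refine Finset.sum_congr rfl fun i _ => Finset.sum_congr rfl fun j _ => ?_
    have h5 := hx.2 i
    have h6 := hx.2 j
    rw [← hw] at h5 h6
    by_cases hij : i < j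
    · have h7 : ¬ j < i := hij.not_gt
      have h8 : w i ≠ w j := fun h => hij.ne ((hinj i j).1 h)
      simp only [walls, ltInd, ← hw, hij, h7, if_true, if_false, true_and, add_zero, and_true]
      rcases h5 with ⟨h5, h5'⟩ | ⟨h5, h5'⟩ <;> rcases h6 with ⟨h6, h6'⟩ | ⟨h6, h6'⟩ <;>
        rw [h5, h6] <;> by_cases h9 : w j < w i <;> simp [h9]
      -- Offsets 0 at i and 1 at j exclude an inversion, as w(i) ≤ i < j ≤ w(j).
      exact absurd (h5'.trans_lt (hij.trans_le h6')) h9.not_gt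
    · simp [hij]
  have h5 : (∑ i, ∑ j, if offset x i = 1 ∧ ¬ offset x j = 1 ∧ i < j then (1 : ℤ) else 0) +
      (∑ i, ∑ j, if offset x j = 1 ∧ ¬ offset x i = 1 ∧ i < j then 1 else 0) = (g : ℤ) ^ 2 := by
    obtain ⟨h6, h7⟩ := sum_offset_eq_one hx
    rw [Finset.sum_comm (f := fun i j => if offset x j = 1 ∧ ¬ offset x i = 1 ∧ i < j then
      (1 : ℤ) else 0), sq]
    nth_rewrite 1 [← h6]
    rw [← h7, Finset.sum_mul_sum, ← Finset.sum_add_distrib]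
    refine Finset.sum_congr rfl fun i _ => ?_
    rw [← Finset.sum_add_distrib]
    refine Finset.sum_congr rfl fun j _ => ?_
    by_cases c1 : offset x i = 1 <;> by_cases c2 : offset x j = 1 <;> simp [c1, c2]
    rcases lt_trichotomy i j with h | rfl | h
    · simp [h, h.le]
    · exact absurd c1 c2
    · simp [h, h.le]
  have h6 := sum_inversions w (fun i => offset x i = 1)
    (fun i hi => by have := hx.2 i; rw [← hw] at this; omega)
    (fun i hi => by have := hx.2 i; rw [← hw] at this; omega)
  have h7 := sum_ne_eq_two_mul_peaks_add_doubles w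
  rw [h1, h2, h3, h4]
  linarith

theorem low_injective : Function.Injective (low : Fin g → Fin (2 * g)) := by
  intro i j h
  have := congrArg Fin.val h
  exact Fin.ext this

theorem sum_eq_sum_low {M : Type*} [AddCommMonoid M] (f : Fin (2 * g) → M) :
    ∑ k, f k = (∑ i : Fin g, f (low i)) + ∑ i : Fin g, f (low i).rev := by
  rw [← Equiv.sum_comp (halves g), Fintype.sum_sum_type]
  rfl

theorem sum_perm_ne {x : ExtAffWeyl g} :
    (∑ i, if perm x i ≠ i then (1 : ℤ) else 0) = 2 * (g - (fixedPts x).card) := by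
  have h : ((fixedPts x).card : ℤ) = ∑ i : Fin g, if perm x (low i) = low i then 1 else 0 := by
    rw [fixedPts, Finset.card_filter]
    push_cast
    rfl
  have h1 : (g : ℤ) - (fixedPts x).card = ∑ i : Fin g, if perm x (low i) ≠ low i then 1 else 0 := by
    have h2 : (g : ℤ) = ∑ i : Fin g, 1 := by simp
    rw [h]
    nth_rewrite 1 [h2]
    rw [← Finset.sum_sub_distrib]
    refine Finset.sum_congr rfl fun i _ => ?_
    by_cases h2 : perm x (low i) = low i <;> simp [h2]
  have h2 : (∑ i : Fin g, if perm x (low i).rev ≠ (low i).rev then (1 : ℤ) else 0) =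
      ∑ i : Fin g, if perm x (low i) ≠ low i then 1 else 0 := by
    refine Finset.sum_congr rfl fun i _ => ?_
    simp only [perm_rev, ne_eq, Fin.rev_inj]
  rw [sum_eq_sum_low, h1, h2]
  ring

theorem four_mul_length_add {d : ℕ} {x : ExtAffWeyl g} (hx : x ∈ admRank g d) :
    4 * (length x : ℤ) + 2 * (g - d) + (2 * crossings (perm x) + 2 * crossings (perm x)⁻¹ +
      flips (perm x) + doubles (perm x)) = 2 * (g : ℤ) ^ 2 + 2 * g := by
  have h1 := wallSum_of_isPermissible (isPermissible_of_mem_adm hx.1)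
  rw [sum_perm_ne, hx.2] at h1
  rw [four_mul_length_of_mem_adm hx.1]
  linarith

/-! ### Constructing admissible elements -/

/-- The permutation `i ↦ i + g` modulo `2g`. -/
def halfTurnPerm (g : ℕ) : Equiv.Perm (Fin (2 * g)) :=
  Function.Involutive.toPerm
    (fun i => if h : (i : ℕ) < g then ⟨i + g, by omega⟩ else ⟨i - g, by omega⟩) (by
      intro i
      ext
      by_cases h : (i : ℕ) < g
      · simp [h]
      · have := i.isLt
        have h2 : (i : ℕ) - g < g := by omega
        simp [h, h2]
        omega)

theorem halfTurnPerm_val (i : Fin (2 * g)) :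
    (halfTurnPerm g i : ℕ) = if (i : ℕ) < g then (i : ℕ) + g else i - g := by
  change ((if h : (i : ℕ) < g then (⟨i + g, by omega⟩ : Fin (2 * g)) else ⟨i - g, by omega⟩ :
    Fin (2 * g)) : ℕ) = _
  split_ifs <;> rfl

theorem halfTurnPerm_halfTurnPerm (i : Fin (2 * g)) : halfTurnPerm g (halfTurnPerm g i) = i :=
  Function.Involutive.toPerm_involutive _ i

/-- The element of length zero inducing the half turn of the affine Dynkin diagram. -/
def halfTurn (g : ℕ) : ExtAffWeyl g :=
  trans ⟨fun i => if (i : ℕ) < g then 0 else 1, by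
    have key : ∀ k : Fin (2 * g), ((if (k : ℕ) < g then 0 else 1 : ℤ) +
        if (k.rev : ℕ) < g then 0 else 1) = 1 := by
      intro k
      have := k.isLt
      rw [Fin.val_rev]
      split_ifs <;> omega
    intro i j
    simp only [key]⟩ *
  ofWeyl ⟨halfTurnPerm g, by
    rw [mem_weyl_iff]
    intro i
    have := i.isLt
    ext
    rw [halfTurnPerm_val, Fin.val_rev, Fin.val_rev, halfTurnPerm_val]
    split_ifs <;> omega⟩

theorem act_halfTurn (v : Fin (2 * g) → ℝ) (i : Fin (2 * g)) :
    act (halfTurn g) v i = v (halfTurnPerm g i) + if (i : ℕ) < g then 0 else 1 := by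
  have h1 : (cocharPart (halfTurn g)).1 i = (if (i : ℕ) < g then 0 else 1) + 0 := rfl
  have h2 : ((weylPart (halfTurn g))⁻¹ : weyl g).1 i = halfTurnPerm g i := rfl
  rw [act, h1, h2, add_zero]
  push_cast
  rfl

theorem offset_halfTurn (i : Fin (2 * g)) :
    offset (halfTurn g) i = if (i : ℕ) < g then 1 else 0 := by
  rw [halfTurn, offset_trans_mul]
  change (if (halfTurnPerm g i : ℕ) < g then 0 else 1) = _
  have := i.isLt
  rw [halfTurnPerm_val]
  split_ifs <;> first | rfl | omega

theorem halfTurnPerm_rev (i : Fin (2 * g)) : halfTurnPerm g i.rev = (halfTurnPerm g i).rev :=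
  perm_rev (halfTurn g) i

theorem halfTurn_mem_Omega : halfTurn g ∈ Omega g := by
  have hstep : ∀ v ∈ baseAlcove g, ∀ i j : Fin (2 * g), i < j →
      ∀ a b : ℝ, (a = if (i : ℕ) < g then 0 else 1) → (b = if (j : ℕ) < g then 0 else 1) →
      -1 < v (halfTurnPerm g i) + a - (v (halfTurnPerm g j) + b) ∧
        v (halfTurnPerm g i) + a - (v (halfTurnPerm g j) + b) < 0 := by
    rintro v ⟨-, hv⟩ i j hij a b rfl rfl
    rw [Fin.lt_def] at hij
    have hj := j.isLt
    by_cases hi : (i : ℕ) < g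
    · by_cases hj' : (j : ℕ) < g
      · have := hv (halfTurnPerm g i) (halfTurnPerm g j) (by
          rw [Fin.lt_def, halfTurnPerm_val, halfTurnPerm_val, if_pos hi, if_pos hj']
          omega)
        rw [if_pos hi, if_pos hj']
        constructor <;> linarith
      · have := hv (halfTurnPerm g j) (halfTurnPerm g i) (by
          rw [Fin.lt_def, halfTurnPerm_val, halfTurnPerm_val, if_pos hi, if_neg hj']
          omega)
        rw [if_pos hi, if_neg hj']
        constructor <;> linarith
    · have hj' : ¬ (j : ℕ) < g := by omega
      have := hv (halfTurnPerm g i) (halfTurnPerm g j) (by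
        rw [Fin.lt_def, halfTurnPerm_val, halfTurnPerm_val, if_neg hi, if_neg hj']
        omega)
      rw [if_neg hi, if_neg hj']
      constructor <;> linarith
  have hrevif : ∀ i : Fin (2 * g), (if (i.rev : ℕ) < g then (0 : ℝ) else 1) =
      1 - if (i : ℕ) < g then 0 else 1 := by
    intro i
    have := i.isLt
    rw [Fin.val_rev]
    split_ifs <;> first | (exfalso; omega) | norm_num
  have hswap : ∀ i : Fin (2 * g), (if (halfTurnPerm g i : ℕ) < g then (0 : ℝ) else 1) =
      1 - if (i : ℕ) < g then 0 else 1 := by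
    intro i
    have := i.isLt
    rw [halfTurnPerm_val]
    split_ifs <;> first | (exfalso; omega) | norm_num
  apply Set.Subset.antisymm
  · rintro _ ⟨v, hv, rfl⟩
    refine ⟨fun i j => ?_, fun i j hij => ?_⟩
    · have := hv.1 (halfTurnPerm g i) (halfTurnPerm g j)
      simp only [act_halfTurn, hrevif, halfTurnPerm_rev]
      linarith
    · simp only [act_halfTurn]
      exact hstep v hv i j hij _ _ rfl rfl
  · intro v hv
    -- The square of the half turn is translation by (1, …, 1), so a preimage is the image shifted
    -- by −1.
    refine ⟨fun i => v (halfTurnPerm g i) + ((if (i : ℕ) < g then 0 else 1) - 1),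
      ⟨fun i j => ?_, fun i j hij => ?_⟩, ?_⟩
    · have := hv.1 (halfTurnPerm g i) (halfTurnPerm g j)
      simp only [hrevif, halfTurnPerm_rev]
      linarith
    · have := hstep v hv i j hij _ _ rfl rfl
      constructor <;> linarith
    · funext i
      rw [act_halfTurn, halfTurnPerm_halfTurnPerm, hswap]
      ring

/-- Reflexivity of `bruhat` requires a factorisation through Ω. The half turn provides it, having
the same multiplier 1 as t^{wμ}. -/
theorem trans_mu_mem_adm (w : weyl g) : trans (weylActFun w (mu g)) ∈ adm g := by
  set y : ExtAffWeyl g := trans (weylActFun w (mu g)) with hy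
  have hw : (halfTurn g)⁻¹ * y ∈ affWeyl g := by
    rw [mem_affWeyl_iff]
    intro i
    have h1 := (isPermissible_trans_mu w).1 i
    have h2 : ∀ k, offset (halfTurn g) ((perm (halfTurn g)⁻¹) k) + offset (halfTurn g)⁻¹ k = 0 := by
      intro k
      rw [← offset_mul, mul_inv_cancel, offset_one]
    have h3 := h2 (perm y i)
    have h4 := h2 (perm y i).rev
    have h5 : ∀ k : Fin (2 * g), offset (halfTurn g) k + offset (halfTurn g) k.rev = 1 := by
      intro k
      have := k.isLt
      rw [offset_halfTurn, offset_halfTurn, Fin.val_rev]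
      split_ifs <;> first | rfl | omega
    have h6 := h5 (perm (halfTurn g)⁻¹ (perm y i))
    rw [perm_rev] at h4
    rw [offset_mul, offset_mul, perm_rev]
    rw [← hy] at h1
    omega
  exact ⟨w, halfTurn g, halfTurn_mem_Omega, _, hw, _, hw, (mul_inv_cancel_left _ _).symm,
    (mul_inv_cancel_left _ _).symm, .refl⟩

theorem mul_simpleReflection_mem_adm {x : ExtAffWeyl g} (hx : x ∈ adm g) {a b : Fin (2 * g)}
    (hab : IsSimplePair a b) (hneg : walls x a b < 0) : x * simpleReflection a b ∈ adm g := by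
  obtain ⟨u, c, hc, w, hw, w', hw', rfl, h1, h2⟩ := hx
  have hws := mul_mem_affWeyl hw (simpleReflection_mem_affWeyl hab)
  refine ⟨u, c, hc, w * simpleReflection a b, hws, w', hw', mul_assoc _ _ _, h1, ?_⟩
  refine Relation.ReflTransGen.head ⟨⟨simpleReflection a b, ?_, ?_⟩, ?_⟩ h2
  · refine ⟨1, mem_affWeyl_iff.2 fun i => rfl, _, mem_simpleAffRefl_iff.2 ⟨a, b, hab, rfl⟩, ?_⟩
    simp
  · rw [mul_simpleReflection_cancel w hab]
  · rw [walls_mul, walls_eq_zero_of_mem_Omega hc, zero_add] at hneg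
    have h3 := four_mul_affLength hw
    have h4 := four_mul_affLength hws
    rw [wallSum_mul_simpleReflection_of_neg hab hneg] at h4
    omega

theorem exists_translation_mem_adm (p : Fin g → Prop) :
    ∃ x ∈ adm g, (∀ i, perm x i = i) ∧ (∀ i : Fin g, p i → offset x (low i) = 1) ∧
      ∀ i : Fin g, ¬ p i → offset x (low i) = 0 := by
  classical
  let u : Fin g → ZMod 2 := fun i => if p i then 0 else 1
  refine ⟨_, trans_mu_mem_adm (ofSigns u), fun i => rfl, ?_⟩
  have h : ∀ i : Fin g, offset (trans (weylActFun (ofSigns u) (mu g))) (low i) =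
      (mu g).1 (halves g (flipFun u (Sum.inl i))) := by
    intro i
    rw [offset_trans]
    change (mu g).1 (halves g (flipFun u ((halves g).symm (halves g (Sum.inl i))))) = _
    rw [Equiv.symm_apply_apply]
  constructor
  · intro i hi
    rw [h]
    have h2 : flipFun u (Sum.inl i) = Sum.inl i := by simp [flipFun, u, hi]
    rw [h2]
    simp [mu, halves, low]
  · intro i hi
    rw [h]
    have h2 : flipFun u (Sum.inl i) = Sum.inr i := by simp [flipFun, u, hi]
    rw [h2]
    have := i.isLt
    simp only [mu, halves, low, Equiv.coe_fn_mk, Sum.elim_inr, Fin.val_rev, Fin.val_castLE]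
    rw [if_neg (by omega)]

theorem wallSum_of_perm_eq {x : ExtAffWeyl g} (hx : x ∈ adm g) (h : ∀ i, perm x i = i) :
    wallSum x = 2 * (g : ℤ) ^ 2 + 2 * g := by
  have h1 := wallSum_of_isPermissible (isPermissible_of_mem_adm hx)
  have h2 : perm x = 1 := Equiv.ext h
  have h3 : crossings (1 : Equiv.Perm (Fin (2 * g))) = 0 := by
    rw [crossings, Finset.card_eq_zero, Finset.filter_eq_empty_iff]
    rintro ⟨i, j⟩ - ⟨h3, h4, -⟩
    exact lt_asymm h3 h4
  have h4 : flips (1 : Equiv.Perm (Fin (2 * g))) = 0 := by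
    rw [flips, Finset.card_eq_zero, Finset.filter_eq_empty_iff]
    simp
  have h5 : doubles (1 : Equiv.Perm (Fin (2 * g))) = 0 := by
    rw [doubles, Finset.card_eq_zero, Finset.filter_eq_empty_iff]
    simp
  rw [h2, inv_one, h3, h4, h5] at h1
  simpa using h1

theorem low_ne_low_rev (i j : Fin g) : low i ≠ (low j).rev := by
  intro h
  have := congrArg Fin.val h
  have hi := i.isLt
  have hj := j.isLt
  simp only [low, Fin.val_rev, Fin.val_castLE] at this
  omega

/-- Multiplying a translation by the commuting simple reflections `s_{12}, s_{34}, …`. -/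
theorem exists_mem_adm_of_pairs (p : Fin g → Prop) (k : ℕ) (hk : 2 * k ≤ g)
    (hp : ∀ i : Fin g, (i : ℕ) < 2 * k → (p i ↔ (i : ℕ) % 2 = 1)) :
    ∃ x ∈ adm g, wallSum x = 2 * (g : ℤ) ^ 2 + 2 * g - 4 * k ∧
      (∀ i : Fin g, (i : ℕ) < 2 * k → perm x (low i) ≠ low i) ∧
      ∀ i : Fin g, 2 * k ≤ (i : ℕ) → perm x (low i) = low i ∧
        (p i → offset x (low i) = 1) ∧ (¬ p i → offset x (low i) = 0) := by
  suffices H : ∀ m ≤ k, ∃ x ∈ adm g, wallSum x = 2 * (g : ℤ) ^ 2 + 2 * g - 4 * m ∧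
      (∀ i : Fin g, (i : ℕ) < 2 * m → perm x (low i) ≠ low i) ∧
      ∀ i : Fin g, 2 * m ≤ (i : ℕ) → perm x (low i) = low i ∧
        (p i → offset x (low i) = 1) ∧ (¬ p i → offset x (low i) = 0) from H k le_rfl
  intro m hm
  induction m with
  | zero =>
    obtain ⟨x, hx, h1, h2, h3⟩ := exists_translation_mem_adm p
    refine ⟨x, hx, ?_, fun i hi => absurd hi (by omega), fun i _ => ⟨h1 _, h2 i, h3 i⟩⟩
    rw [wallSum_of_perm_eq hx h1]
    simp
  | succ m ih =>
    obtain ⟨x, hx, h1, h2, h3⟩ := ih (by omega)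
    let i₀ : Fin g := ⟨2 * m, by omega⟩
    let i₁ : Fin g := ⟨2 * m + 1, by omega⟩
    have hab : IsSimplePair (low i₀) (low i₁) := .inl ⟨rfl, by
      change 2 * m + 1 ≤ g
      omega⟩
    have h01 : low i₀ < low i₁ := by
      rw [Fin.lt_def]
      change 2 * m < 2 * m + 1
      omega
    have e0 := h3 i₀ le_rfl
    have e1 := h3 i₁ (by change 2 * m ≤ 2 * m + 1; omega)
    have p0 : ¬ p i₀ := by
      rw [hp i₀ (by change 2 * m < _; omega)]
      change ¬ 2 * m % 2 = 1
      omega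
    have p1 : p i₁ := by
      rw [hp i₁ (by change 2 * m + 1 < _; omega)]
      change (2 * m + 1) % 2 = 1
      omega
    -- The alternating pattern of `p` puts offset 0 before offset 1, which makes this pair a
    -- descent.
    have hneg : walls x (low i₀) (low i₁) < 0 := by
      rw [walls, e0.2.2 p0, e1.2.1 p1, e0.1, e1.1]
      omega
    have hperm : ∀ i, perm (simpleReflection (low i₀) (low i₁)) (low i) =
        if i = i₀ then low i₁ else if i = i₁ then low i₀ else low i := by
      intro i
      simp only [simpleReflection, perm_affReflection, low_injective.eq_iff, low_ne_low_rev, if_false]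
    have hoff : ∀ i, i ≠ i₀ → i ≠ i₁ →
        offset (simpleReflection (low i₀) (low i₁)) (low i) = 0 := by
      intro i hi0 hi1
      simp only [simpleReflection, offset_affReflection hab.ne, low_injective.eq_iff, low_ne_low_rev,
        if_false, hi0, hi1]
    refine ⟨x * simpleReflection (low i₀) (low i₁), mul_simpleReflection_mem_adm hx hab hneg,
      ?_, ?_, ?_⟩
    · rw [wallSum_mul_simpleReflection_of_neg hab hneg, h1]
      push_cast
      ring
    · intro i hi
      rw [perm_mul_apply, hperm]
      split_ifs with c0 c1
      · rw [e1.1, c0]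
        exact h01.ne'
      · rw [e0.1, c1]
        exact h01.ne
      · refine h2 i ?_
        have c0' : (i : ℕ) ≠ 2 * m := fun h => c0 (Fin.ext h)
        have c1' : (i : ℕ) ≠ 2 * m + 1 := fun h => c1 (Fin.ext h)
        omega
    · intro i hi
      have c0 : i ≠ i₀ := fun h => by
        have : (i : ℕ) = 2 * m := congrArg Fin.val h
        omega
      have c1 : i ≠ i₁ := fun h => by
        have : (i : ℕ) = 2 * m + 1 := congrArg Fin.val h
        omega
      have hpi : perm (simpleReflection (low i₀) (low i₁)) (low i) = low i := by
        rw [hperm, if_neg c0, if_neg c1]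
      rw [perm_mul_apply, offset_mul, hpi, hoff i c0 c1, add_zero]
      exact h3 i (by omega)

theorem card_fixedPts_of {x : ExtAffWeyl g} {m : ℕ} (hm : m ≤ g)
    (h1 : ∀ i : Fin g, (i : ℕ) < m → perm x (low i) ≠ low i)
    (h2 : ∀ i : Fin g, m ≤ (i : ℕ) → perm x (low i) = low i) : (fixedPts x).card = g - m := by
  have h : (fixedPts x)ᶜ = Finset.univ.filter fun i : Fin g => (i : ℕ) < m := by
    ext i
    rw [Finset.mem_compl, fixedPts, Finset.mem_filter, Finset.mem_filter]
    simp only [Finset.mem_univ, true_and]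
    constructor
    · intro hi
      by_contra hcon
      exact hi (h2 i (by omega))
    · exact h1 i
  have h3 := Finset.card_compl (fixedPts x)
  rw [h, Fin.card_filter_val_lt, Fintype.card_fin, min_eq_right hm] at h3
  have h4 := (fixedPts x).card_le_univ
  rw [Fintype.card_fin] at h4
  omega

/-- There is an admissible element of `p`-rank `d` of length `(g² + d) / 2`, rounded down. -/
theorem exists_mem_admRank {d : ℕ} (hd : d ≤ g) :
    ∃ x ∈ admRank g d,
      wallSum x + 4 * (((g - d + 1) / 2 : ℕ) : ℤ) = 2 * (g : ℤ) ^ 2 + 2 * g := by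
  rcases Nat.even_or_odd (g - d) with ⟨k, hk⟩ | ⟨k, hk⟩
  · obtain ⟨x, hx, h1, h2, h3⟩ := exists_mem_adm_of_pairs (fun i : Fin g => (i : ℕ) % 2 = 1) k
      (by omega) (fun i _ => Iff.rfl)
    refine ⟨x, ⟨hx, ?_⟩, ?_⟩
    · rw [card_fixedPts_of (by omega) h2 fun i hi => (h3 i hi).1]
      omega
    · rw [h1, show (g - d + 1) / 2 = k by omega]
      ring
  · let p : Fin g → Prop := fun i => (i : ℕ) < 2 * k ∧ (i : ℕ) % 2 = 1
    obtain ⟨x, hx, h1, h2, h3⟩ := exists_mem_adm_of_pairs p k (by omega)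
      fun i hi => ⟨fun h => h.2, fun h => ⟨hi, h⟩⟩
    -- For odd g − d one further index is made non-fixed by s_g, which exchanges the two middle
    -- points. The offset 0 at `e` makes this a descent; it is disjoint from the earlier pairs.
    let e : Fin g := ⟨g - 1, by omega⟩
    have he := h3 e (by change 2 * k ≤ g - 1; omega)
    have hpe : ¬ p e := fun h => by
      have : g - 1 < 2 * k := h.1
      omega
    have hab : IsSimplePair (low e) (low e).rev := by
      refine .inl ⟨?_, ?_⟩ <;> rw [Fin.val_rev]
      · change g - 1 + 1 = 2 * g - (g - 1 + 1)
        omega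
      · change 2 * g - (g - 1 + 1) ≤ g
        omega
    have hlt : low e < (low e).rev := by
      rw [Fin.lt_def]
      have : ((low e).rev : ℕ) ≤ g ∧ (low e : ℕ) + 1 = ((low e).rev : ℕ) := by
        rcases hab with h | h
        · exact ⟨h.2, h.1⟩
        · have : (low e : ℕ) = g - 1 := rfl
          omega
      omega
    have hneg : walls x (low e) (low e).rev < 0 := by
      have h4 := (isPermissible_of_mem_adm hx).1 (low e)
      have h5 := he.2.2 hpe
      have h6 : ltInd (low e).rev (low e) = 0 := if_neg hlt.not_gt
      rw [walls, perm_rev, he.1, h6]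
      omega
    have hperm : ∀ i, perm (simpleReflection (low e) (low e).rev) (low i) =
        if i = e then (low e).rev else low i := by
      intro i
      simp only [simpleReflection, perm_affReflection, low_injective.eq_iff, low_ne_low_rev,
        if_false, Fin.rev_rev]
      split_ifs <;> rfl
    refine ⟨x * simpleReflection (low e) (low e).rev,
      ⟨mul_simpleReflection_mem_adm hx hab hneg, ?_⟩, ?_⟩
    · have h4 : fixedPts (x * simpleReflection (low e) (low e).rev) = (fixedPts x).erase e := by
        ext i
        rw [Finset.mem_erase, fixedPts, fixedPts, Finset.mem_filter, Finset.mem_filter]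
        simp only [Finset.mem_univ, true_and]
        change perm (x * _) (low i) = low i ↔ i ≠ e ∧ perm x (low i) = low i
        rw [perm_mul_apply, hperm]
        split_ifs with hi
        · rw [perm_rev, he.1, hi]
          simp [(low_ne_low_rev e e).symm]
        · simp [hi]
      have h5 : e ∈ fixedPts x := by
        rw [fixedPts, Finset.mem_filter]
        exact ⟨Finset.mem_univ _, he.1⟩
      rw [h4, Finset.card_erase_of_mem h5,
        card_fixedPts_of (by omega) h2 fun i hi => (h3 i hi).1]
      omega
    · rw [wallSum_mul_simpleReflection_of_neg hab hneg, h1, show (g - d + 1) / 2 = k + 1 by omega]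
      push_cast
      ring

/-! ### Permutations without crossings -/

section Permutations

variable {n : ℕ} {w : Equiv.Perm (Fin n)}

theorem crossings_eq_zero_iff :
    crossings w = 0 ↔ ∀ i j, i < j → j < w i → ¬ w i < w j := by
  rw [crossings, Finset.card_eq_zero, Finset.filter_eq_empty_iff]
  constructor
  · intro h i j h1 h2 h3
    exact h (Finset.mem_univ (i, j)) ⟨h1, h2, h3⟩
  · rintro h ⟨i, j⟩ - ⟨h1, h2, h3⟩
    exact h i j h1 h2 h3

theorem crossings_inv_eq_zero_iff :
    crossings w⁻¹ = 0 ↔ ∀ i j, w i < w j → w j < i → ¬ i < j := by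
  have h : ∀ k, w⁻¹ (w k) = k := w.symm_apply_apply
  rw [crossings_eq_zero_iff]
  constructor
  · intro h' i j h1 h2
    have := h' (w i) (w j) h1
    rw [h, h] at this
    exact this h2
  · intro h' i j
    obtain ⟨i, rfl⟩ := w.surjective i
    obtain ⟨j, rfl⟩ := w.surjective j
    rw [h, h]
    exact h' i j

/-- A permutation without crossings, double ascents and double descents is an involution. -/
theorem involutive_of_noncrossing (hA : ∀ i j, i < j → j < w i → ¬ w i < w j)
    (hB : ∀ i j, w i < w j → w j < i → ¬ i < j) (hD : ∀ i, i < w i → w (w i) < w i)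
    (hD' : ∀ i, w i < i → w i < w (w i)) (i : Fin n) : w (w i) = i := by
  have hinj : ∀ {a b}, w a = w b → a = b := fun h => w.injective h
  -- Induction on the length of an upward arc: shorter upward arcs nested inside it close up into
  -- transpositions.
  have key : ∀ (m : ℕ) (i : Fin n), i < w i → (w i : ℕ) - i = m → w (w i) = i := by
    intro m
    induction m using Nat.strong_induction_on with
    | _ m ih =>
    intro i hi hm
    rw [Fin.lt_def] at hi
    have ih' : ∀ p, p < w p → i ≤ p → w p ≤ w i → (i < p ∨ w p < w i) → w (w p) = p := by
      intro p hp h1 h2 h3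
      rw [Fin.lt_def] at hp
      rw [Fin.le_def] at h1 h2
      rw [Fin.lt_def, Fin.lt_def] at h3
      exact ih _ (by omega) p hp rfl
    rw [← Fin.lt_def] at hi
    by_contra hne
    have hkj := hD i hi
    -- If w(w(i)) < i, the point m' = w⁻¹(i) and p = w⁻¹(m') satisfy i < p < m' < w(i), so the
    -- nested arc p → m' closes up and w(m') = p, contradicting w(m') = i. If w(w(i)) > i, the
    -- nested arc starting at w(w(i)) closes up, and injectivity gives w(w(i)) = i.
    rcases lt_or_gt_of_ne hne with hki | hik
    · obtain ⟨m', hm'⟩ := w.surjective i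
      have hmi : i < m' := by
        rcases lt_trichotomy m' i with h | h | h
        · have := hD m' (by rwa [hm'])
          rw [hm'] at this
          exact absurd this hi.not_gt
        · rw [h] at hm'
          exact absurd hm' hi.ne'
        · exact h
      have hmj : m' < w i := by
        rcases lt_trichotomy m' (w i) with h | h | h
        · exact h
        · rw [← h] at hne
          exact absurd hm' hne
        · exact absurd h (hB (w i) m' (by rwa [hm']) (by rwa [hm']))
      obtain ⟨p, hp⟩ := w.surjective m'
      have hpm : p < m' := by
        rcases lt_trichotomy p m' with h | h | h
        · exact h
        · rw [h] at hp
          rw [hp] at hm'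
          exact absurd hm' hmi.ne'
        · have := hD' p (by rwa [hp])
          rw [hp, hm'] at this
          exact absurd this hmi.not_gt
      have hip : i < p := by
        rcases lt_trichotomy p i with h | h | h
        · exact absurd (hp ▸ hmj) (hA p i h (by rwa [hp]))
        · rw [h] at hp
          exact absurd hp hmj.ne'
        · exact h
      have := ih' p (by rwa [hp]) hip.le (hp ▸ hmj.le) (.inl hip)
      rw [hp, hm'] at this
      exact hip.ne this
    · have h1 := hD' (w i) hkj
      have h2 : w (w (w i)) ≤ w i := by
        have := hA i (w (w i)) hik hkj
        exact not_lt.1 this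
      have h3 := ih' (w (w i)) h1 hik.le h2 (.inl hik)
      exact hik.ne' (hinj (hinj h3).symm).symm
  rcases lt_trichotomy i (w i) with h | h | h
  · exact key _ i h rfl
  · rw [← h, ← h]
  · exact w.injective (key _ (w i) (hD' i h) rfl)

theorem doubles_eq_zero_iff :
    doubles w = 0 ↔ (∀ i, i < w i → w (w i) ≤ w i) ∧ ∀ i, w i < i → w i ≤ w (w i) := by
  have h : ∀ k, w⁻¹ (w k) = k := w.symm_apply_apply
  rw [doubles, Finset.card_eq_zero, Finset.filter_eq_empty_iff]
  constructor
  · intro h'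
    constructor <;> intro i hi <;> have := h' (Finset.mem_univ (w i)) <;> rw [h] at this <;>
      by_contra! hcon
    · exact this (.inl ⟨hi, hcon⟩)
    · exact this (.inr ⟨hcon, hi⟩)
  · rintro ⟨h1, h2⟩ j -
    obtain ⟨i, rfl⟩ := w.surjective j
    rw [h]
    rintro (⟨h3, h4⟩ | ⟨h3, h4⟩)
    · exact absurd (h1 i h3) h4.not_ge
    · exact absurd (h2 i h4) h3.not_ge

theorem involutive_of_crossings_eq_zero (h1 : crossings w = 0) (h2 : crossings w⁻¹ = 0)
    (h3 : doubles w = 0) (i : Fin n) : w (w i) = i := by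
  rw [crossings_eq_zero_iff] at h1
  rw [crossings_inv_eq_zero_iff] at h2
  rw [doubles_eq_zero_iff] at h3
  refine involutive_of_noncrossing h1 h2 (fun i hi => ?_) (fun i hi => ?_) i
  · exact lt_of_le_of_ne (h3.1 i hi) fun h => hi.ne' (w.injective h)
  · exact lt_of_le_of_ne (h3.2 i hi) fun h => hi.ne (w.injective h).symm

theorem doubles_eq_zero_of_involutive (h : ∀ i, w (w i) = i) : doubles w = 0 := by
  rw [doubles_eq_zero_iff]
  exact ⟨fun i hi => (h i).trans_le hi.le, fun i hi => hi.le.trans_eq (h i).symm⟩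

theorem doubles_inv : doubles w⁻¹ = doubles w := by
  rw [doubles, doubles, inv_inv]
  congr 1
  ext j
  simp only [Finset.mem_filter, Finset.mem_univ, true_and]
  tauto

/-- A permutation without crossings with exactly one double ascent and no double descent consists
of one cycle of length three and transpositions. -/
theorem exists_threeCycle_of_noncrossing {a b : Fin n}
    (hA : ∀ i j, i < j → j < w i → ¬ w i < w j) (hB : ∀ i j, w i < w j → w j < i → ¬ i < j)
    (hab : w a = b) (h1 : a < b) (h2 : b < w b)
    (hD : ∀ i, i ≠ a → i < w i → w (w i) < w i) (hD' : ∀ i, w i < i → w i < w (w i)) :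
    ∃ c, a ≠ b ∧ a ≠ c ∧ b ≠ c ∧ w a = b ∧ w b = c ∧ w c = a ∧
      ∀ i, i ≠ a → i ≠ b → i ≠ c → w (w i) = i := by
  obtain ⟨c, hc⟩ : ∃ c, w b = c := ⟨_, rfl⟩
  rw [hc] at h2
  -- Bypassing b replaces a → b → c by a → c and fixes b. The result has no crossings and no double
  -- points, so it is an involution; hence w(c) = a.
  set τ := w * Equiv.swap a b with hτ
  have hinj : ∀ i j, w i = w j ↔ i = j := fun i j => w.injective.eq_iff
  have ta : τ a = c := by simp [hτ, hc]
  have tb : τ b = b := by simp [hτ, hab]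
  have tn : ∀ i, i ≠ a → i ≠ b → τ i = w i := by
    intro i hi hi'
    simp [hτ, Equiv.swap_apply_of_ne_of_ne hi hi']
  have hcb := hD b h1.ne' (hc ▸ h2)
  rw [hc] at hcb
  have hw : ∀ i, w i = b → i = a := fun i hi => (hinj i a).1 (hi.trans hab.symm)
  have hw' : ∀ i, w i = c → i = b := fun i hi => (hinj i b).1 (hi.trans hc.symm)
  have key : ∀ i, τ (τ i) = i := by
    refine involutive_of_noncrossing ?_ ?_ ?_ ?_
    · intro i j hij h3 h4
      by_cases hia : i = a
      · subst hia
        rw [ta] at h3 h4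
        by_cases hjb : j = b
        · subst hjb
          rw [tb] at h4
          exact absurd h4 h2.not_gt
        · rw [tn j hij.ne' hjb] at h4
          rcases lt_or_gt_of_ne hjb with h5 | h5
          · exact hA i j hij (by rwa [hab]) (by rw [hab]; exact h2.trans h4)
          · exact hA b j h5 (by rwa [hc]) (by rwa [hc])
      · by_cases hib : i = b
        · subst hib
          rw [tb] at h3
          exact absurd h3 hij.not_gt
        · rw [tn i hia hib] at h3 h4
          by_cases hja : j = a
          · subst hja
            rw [ta] at h4
            rcases lt_trichotomy (w i) b with h5 | h5 | h5
            · exact hA i j hij h3 (by rwa [hab])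
            · exact hia (hw i h5)
            · exact hA i b (hij.trans h1) h5 (by rwa [hc])
          · by_cases hjb : j = b
            · subst hjb
              rw [tb] at h4
              exact absurd h4 h3.not_gt
            · rw [tn j hja hjb] at h4
              exact hA i j hij h3 h4
    · intro i j h3 h4 hij
      by_cases hia : i = a
      · subst hia
        rw [ta] at h3
        exact absurd (h3.trans h4) (h1.trans h2).not_gt
      · by_cases hib : i = b
        · subst hib
          rw [tb] at h3
          exact absurd h4 h3.not_gt
        · by_cases hja : j = a
          · subst hja
            rw [ta] at h4
            exact absurd (h4.trans hij) (h1.trans h2).not_gt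
          · by_cases hjb : j = b
            · subst hjb
              rw [tb] at h4
              exact absurd h4 hij.not_gt
            · rw [tn i hia hib] at h3
              rw [tn j hja hjb] at h3 h4
              exact hB i j h3 h4 hij
    · intro i hi
      by_cases hia : i = a
      · subst hia
        rw [ta, tn c (h1.trans h2).ne' h2.ne']
        exact hcb
      · by_cases hib : i = b
        · subst hib
          rw [tb] at hi
          exact absurd hi (lt_irrefl _)
        · rw [tn i hia hib] at hi ⊢
          have h3 := hD i hia hi
          rw [tn (w i) (fun h => ?_) fun h => hia (hw i h)]
          · exact h3
          · rw [h, hab] at h3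
            exact absurd h3 h1.not_gt
    · intro i hi
      by_cases hia : i = a
      · subst hia
        rw [ta] at hi
        exact absurd hi (h1.trans h2).not_gt
      · by_cases hib : i = b
        · subst hib
          rw [tb] at hi
          exact absurd hi (lt_irrefl _)
        · rw [tn i hia hib] at hi ⊢
          by_cases h3 : w i = a
          · rw [h3, ta]
            exact h1.trans h2
          · rw [tn (w i) h3 fun h => hia (hw i h)]
            exact hD' i hi
  have hca : w c = a := by
    have := key a
    rwa [ta, tn c (h1.trans h2).ne' h2.ne'] at this
  refine ⟨c, h1.ne, (h1.trans h2).ne, h2.ne, hab, hc, hca, fun i hia hib hic => ?_⟩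
  have h3 := key i
  rw [tn i hia hib] at h3
  rwa [tn (w i) (fun h => hic ((hinj i c).1 (h.trans hca.symm))) fun h => hia (hw i h)] at h3

/-! ### Cycle types of involutions, with or without an additional three-cycle. -/

theorem cycleType_eq_replicate {k : ℕ} (h : ∀ i, w (w i) = i) (hk : w.support.card = 2 * k) :
    w.cycleType = Multiset.replicate k 2 := by
  have h1 : w ^ 2 = 1 := by
    ext i
    rw [sq, Equiv.Perm.mul_apply, h]
    rfl
  have h2 := Equiv.Perm.pow_prime_eq_one_iff.1 h1
  have h3 := w.sum_cycleType
  rw [Multiset.eq_replicate]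
  refine ⟨?_, h2⟩
  have h4 : w.cycleType = Multiset.replicate w.cycleType.card 2 := Multiset.eq_replicate.2 ⟨rfl, h2⟩
  rw [h4, Multiset.sum_replicate, hk] at h3
  rw [smul_eq_mul] at h3
  omega

theorem involutive_of_cycleType {k : ℕ} (h : w.cycleType = Multiset.replicate k 2) :
    (∀ i, w (w i) = i) ∧ w.support.card = 2 * k := by
  constructor
  · have h1 : w ^ 2 = 1 := Equiv.Perm.pow_prime_eq_one_iff.2 fun c hc => by
      rw [h] at hc
      exact Multiset.eq_of_mem_replicate hc
    intro i
    rw [← Equiv.Perm.mul_apply, ← sq, h1]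
    rfl
  · rw [← w.sum_cycleType, h, Multiset.sum_replicate, smul_eq_mul, mul_comm]

theorem cycleType_eq_cons_replicate {k : ℕ} {a b c : Fin n} (hab : a ≠ b) (hac : a ≠ c)
    (hbc : b ≠ c) (ha : w a = b) (hb : w b = c) (hc : w c = a)
    (h : ∀ i, i ≠ a → i ≠ b → i ≠ c → w (w i) = i) (hk : w.support.card = 3 + 2 * k) :
    w.cycleType = 3 ::ₘ Multiset.replicate k 2 := by
  set ρ := Equiv.swap a b * Equiv.swap b c with hρ
  have ra : ρ a = b := by
    simp [hρ, Equiv.swap_apply_of_ne_of_ne hab hac]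
  have rb : ρ b = c := by
    simp [hρ, Equiv.swap_apply_of_ne_of_ne hac.symm hbc.symm]
  have rc : ρ c = a := by simp [hρ]
  have rn : ∀ i, i ≠ a → i ≠ b → i ≠ c → ρ i = i := by
    intro i h1 h2 h3
    simp [hρ, Equiv.swap_apply_of_ne_of_ne h1 h2, Equiv.swap_apply_of_ne_of_ne h2 h3]
  have h3 : ρ.IsThreeCycle := by
    have : ρ = Equiv.swap b a * Equiv.swap b c := by rw [hρ, Equiv.swap_comm a b]
    rw [this]
    exact Equiv.Perm.isThreeCycle_swap_mul_swap_same hab.symm hbc hac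
  set π := ρ⁻¹ * w with hπ
  have hw : w = ρ * π := by rw [hπ, mul_inv_cancel_left]
  have hπ' : ∀ i j, ρ j = w i → π i = j := by
    intro i j hij
    rw [hπ, Equiv.Perm.mul_apply, ← hij]
    exact ρ.symm_apply_apply j
  have pa : π a = a := hπ' _ _ (ra.trans ha.symm)
  have pb : π b = b := hπ' _ _ (rb.trans hb.symm)
  have pc : π c = c := hπ' _ _ (rc.trans hc.symm)
  have hwn : ∀ i, i ≠ a → i ≠ b → i ≠ c → w i ≠ a ∧ w i ≠ b ∧ w i ≠ c := by
    intro i h1 h2 h3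
    exact ⟨fun h => h3 (w.injective (h.trans hc.symm)), fun h => h1 (w.injective (h.trans ha.symm)),
      fun h => h2 (w.injective (h.trans hb.symm))⟩
  have pn : ∀ i, i ≠ a → i ≠ b → i ≠ c → π i = w i := by
    intro i h1 h2 h3
    obtain ⟨h4, h5, h6⟩ := hwn i h1 h2 h3
    exact hπ' _ _ (rn _ h4 h5 h6)
  have hdisj : ρ.Disjoint π := by
    intro i
    by_cases h1 : i = a
    · exact .inr (h1 ▸ pa)
    by_cases h2 : i = b
    · exact .inr (h2 ▸ pb)
    by_cases h3 : i = c
    · exact .inr (h3 ▸ pc)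
    exact .inl (rn i h1 h2 h3)
  have hinv : ∀ i, π (π i) = i := by
    intro i
    by_cases h1 : i = a
    · rw [h1, pa, pa]
    by_cases h2 : i = b
    · rw [h2, pb, pb]
    by_cases h3 : i = c
    · rw [h3, pc, pc]
    obtain ⟨h4, h5, h6⟩ := hwn i h1 h2 h3
    rw [pn i h1 h2 h3, pn _ h4 h5 h6, h i h1 h2 h3]
  have hcard : π.support.card = 2 * k := by
    rw [hw, hdisj.card_support_mul, h3.card_support] at hk
    omega
  rw [hw, hdisj.cycleType_mul, h3.cycleType, cycleType_eq_replicate hinv hcard]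
  rfl

/-- Double points lie on the three-cycle and differ from its maximum. The bound 2 is not sharp, but
a congruence modulo 4 later absorbs the loss. -/
theorem doubles_le_of_cycleType {k : ℕ} (h : w.cycleType = 3 ::ₘ Multiset.replicate k 2) :
    doubles w ≤ 2 ∧ w.support.card = 3 + 2 * k := by
  constructor
  · have h3 : 3 ∈ w.cycleType := by
      rw [h]
      exact Multiset.mem_cons_self _ _
    obtain ⟨c, τ, hw, hdisj, hc, hcard⟩ := Equiv.Perm.mem_cycleType_iff.1 h3
    have hτ : τ.cycleType = Multiset.replicate k 2 := by
      rw [hw, hdisj.cycleType_mul, hc.cycleType, hcard] at h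
      exact (Multiset.cons_inj_right 3).1 h
    have hinv := (involutive_of_cycleType hτ).1
    have hne : c.support.Nonempty := Finset.card_pos.1 (by omega)
    have hsub : Finset.univ.filter (fun j : Fin n => (w⁻¹ j < j ∧ j < w j) ∨
        (w j < j ∧ j < w⁻¹ j)) ⊆ c.support.erase (c.support.max' hne) := by
      intro j hj
      rw [Finset.mem_filter] at hj
      have hj := hj.2
      have hwj : w (w⁻¹ j) = j := w.apply_symm_apply j
      have hjc : j ∈ c.support := by
        rw [Equiv.Perm.mem_support]
        intro hcj
        have h1 : w j = τ j := by
          rw [hw, hdisj.commute.eq, Equiv.Perm.mul_apply, hcj]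
        have h2 : w (τ j) = j := by
          rw [hw, Equiv.Perm.mul_apply, hinv, hcj]
        have h4 : w⁻¹ j = w j := w.injective (by rw [hwj, h1, h2])
        rw [h4] at hj
        rcases hj with hj | hj
        · exact lt_asymm hj.1 hj.2
        · exact lt_asymm hj.1 hj.2
      have hτj : τ j = j := (hdisj j).resolve_left (Equiv.Perm.mem_support.1 hjc)
      have hwc : w j ∈ c.support := by
        rw [hw, Equiv.Perm.mul_apply, hτj]
        exact Equiv.Perm.apply_mem_support.2 hjc
      have hwc' : w⁻¹ j ∈ c.support := by
        have h1 : w (c⁻¹ j) = j := by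
          rw [hw, hdisj.commute.eq, Equiv.Perm.mul_apply,
            show c (c⁻¹ j) = j from c.apply_symm_apply j, hτj]
        have h2 : w⁻¹ j = c⁻¹ j := w.injective (hwj.trans h1.symm)
        rw [h2, ← Equiv.Perm.apply_mem_support, show c (c⁻¹ j) = j from c.apply_symm_apply j]
        exact hjc
      rw [Finset.mem_erase]
      refine ⟨fun hmax => ?_, hjc⟩
      have h1 := c.support.le_max' _ hwc
      have h2 := c.support.le_max' _ hwc'
      rw [← hmax] at h1 h2
      rcases hj with hj | hj
      · exact absurd hj.2 h1.not_gt
      · exact absurd hj.2 h2.not_gt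
    have := Finset.card_le_card hsub
    rw [Finset.card_erase_of_mem (Finset.max'_mem _ _), hcard] at this
    exact this
  · rw [← w.sum_cycleType, h, Multiset.sum_cons, Multiset.sum_replicate, smul_eq_mul, mul_comm]

/-- Passing to the inverse exchanges double ascents and double descents, so the double point may be
taken to be an ascent. -/
theorem cycleType_of_doubles_eq_one {k : ℕ} (h1 : crossings w = 0) (h2 : crossings w⁻¹ = 0)
    (h3 : doubles w = 1) (hk : w.support.card = 3 + 2 * k) :
    w.cycleType = 3 ::ₘ Multiset.replicate k 2 := by
  have main : ∀ v : Equiv.Perm (Fin n), crossings v = 0 → crossings v⁻¹ = 0 → doubles v = 1 →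
      v.support.card = 3 + 2 * k → (∃ b, v⁻¹ b < b ∧ b < v b) →
      v.cycleType = 3 ::ₘ Multiset.replicate k 2 := by
    rintro v h1 h2 h3 hk ⟨b, hb1, hb2⟩
    rw [crossings_eq_zero_iff] at h1
    rw [crossings_inv_eq_zero_iff] at h2
    obtain ⟨e, he⟩ := Finset.card_eq_one.1 h3
    have hdbl : ∀ j, (v⁻¹ j < j ∧ j < v j) ∨ (v j < j ∧ j < v⁻¹ j) → j = e := by
      intro j hj
      rw [← Finset.mem_singleton, ← he, Finset.mem_filter]
      exact ⟨Finset.mem_univ _, hj⟩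
    have hbe := hdbl b (.inl ⟨hb1, hb2⟩)
    have hvb : v (v⁻¹ b) = b := v.apply_symm_apply b
    have hv : ∀ k, v⁻¹ (v k) = k := v.symm_apply_apply
    obtain ⟨c, hab, hac, hbc, ha, hb, hc, hn⟩ := exists_threeCycle_of_noncrossing h1 h2 hvb hb1 hb2
      (fun i hia hi => by
        by_contra hcon
        have hne : v (v i) ≠ v i := fun h => hi.ne' (v.injective h)
        have := hdbl (v i) (.inl (by rw [hv]; exact ⟨hi, lt_of_le_of_ne (not_lt.1 hcon) hne.symm⟩))
        exact hia (v.injective (by rw [this, hvb, hbe])))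
      (fun i hi => by
        by_contra hcon
        have hne : v (v i) ≠ v i := fun h => hi.ne (v.injective h)
        have h4 : v (v i) < v i := lt_of_le_of_ne (not_lt.1 hcon) hne
        have := hdbl (v i) (.inr (by rw [hv]; exact ⟨h4, hi⟩))
        rw [this, ← hbe] at h4
        exact absurd h4 hb2.not_gt)
    exact cycleType_eq_cons_replicate hab hac hbc ha hb hc hn hk
  obtain ⟨b, hb⟩ := Finset.card_pos.1 (h3 ▸ one_pos : 0 < doubles w)
  rw [Finset.mem_filter] at hb
  rcases hb.2 with hb | hb
  · exact main w h1 h2 h3 hk ⟨b, hb⟩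
  · rw [← Equiv.Perm.cycleType_inv]
    refine main w⁻¹ h2 (by rwa [inv_inv]) (by rwa [doubles_inv]) ?_ ⟨b, ?_⟩
    · rwa [Equiv.Perm.support_inv]
    · rw [inv_inv]
      exact hb

end Permutations

/-! ### Elements of maximal length -/

/-- Four times the difference of `(g² + d) / 2` and the length, in terms of the permutation. -/
def excess (w : Equiv.Perm (Fin (2 * g))) : ℕ :=
  2 * crossings w + 2 * crossings w⁻¹ + flips w + doubles w

/-- Since 2g² + 2g is divisible by 4, the excess is 2(g − d) modulo 4. Its least value of this
residue is attained by the constructed element. -/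
theorem isOfMaximalLength_iff {d : ℕ} (hd : d ≤ g) {x : ExtAffWeyl g} (hx : x ∈ admRank g d) :
    IsOfMaximalLength d x ↔ excess (perm x) = 2 * ((g - d) % 2) := by
  obtain ⟨t, ht⟩ : ∃ t : ℤ, 2 * (g : ℤ) ^ 2 + 2 * g = 4 * t := by
    obtain ⟨t, ht⟩ := Int.even_mul_succ_self (g : ℤ)
    exact ⟨t, by linarith⟩
  have hlen : ∀ y ∈ admRank g d,
      4 * (length y : ℤ) + 2 * (g - d) + (excess (perm y) : ℕ) = 4 * t := by
    intro y hy
    rw [← ht, ← four_mul_length_add hy, excess]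
    push_cast
    ring
  have hxl := hlen x hx
  obtain ⟨y, hy, hyl⟩ := exists_mem_admRank hd
  rw [← four_mul_length_of_mem_adm hy.1, ht] at hyl
  constructor
  · rintro ⟨-, h⟩
    have h1 := h y hy
    omega
  · intro h
    refine ⟨hx, fun z hz => ?_⟩
    have h1 := hlen z hz
    omega

/-- Mirroring both positions of a crossing of `w` and exchanging them gives a crossing of the
inverse. -/
theorem crossings_inv_perm (x : ExtAffWeyl g) : crossings (perm x)⁻¹ = crossings (perm x) := by
  have h : (crossings (perm x)⁻¹ : ℤ) = crossings (perm x) := by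
    rw [crossings_inv_eq_sum, crossings_eq_sum, Finset.sum_comm, ← Equiv.sum_comp Fin.revPerm]
    refine Finset.sum_congr rfl fun i _ => ?_
    rw [← Equiv.sum_comp Fin.revPerm]
    refine Finset.sum_congr rfl fun j _ => ?_
    simp only [Fin.revPerm_apply, perm_rev, Fin.rev_lt_rev]
    refine if_congr ?_ rfl rfl
    tauto
  exact_mod_cast h

/-! ### The statistics of `w` in terms of u and σ. -/

section Signed

variable {x₀ : cochar g} {u : Fin g → ZMod 2} {σ : Equiv.Perm (Fin g)}

theorem perm_mk_low (i : Fin g) :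
    perm (mk x₀ u σ) (low i) = if u (σ i) = 1 then (low (σ i)).rev else low (σ i) := by
  have h : perm (mk x₀ u σ) (halves g (Sum.inl i)) =
      halves g (if u (σ i) = 1 then Sum.inr (σ i) else Sum.inl (σ i)) := by
    rw [mk, perm_trans_mul]
    simp [ofSigns, ofPerm, Equiv.permCongr_apply, flipFun]
  change perm (mk x₀ u σ) (halves g (Sum.inl i)) = _
  rw [h]
  split_ifs <;> rfl

theorem perm_mk_low_of_ne {i : Fin g} (h : ¬ u (σ i) = 1) :
    perm (mk x₀ u σ) (low i) = low (σ i) := by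
  rw [perm_mk_low, if_neg h]

theorem perm_mk_low_of_eq {i : Fin g} (h : u (σ i) = 1) :
    perm (mk x₀ u σ) (low i) = (low (σ i)).rev := by
  rw [perm_mk_low, if_pos h]

theorem mem_fixedPts_mk {i : Fin g} : i ∈ fixedPts (mk x₀ u σ) ↔ σ i = i ∧ ¬ u i = 1 := by
  have h : i ∈ fixedPts (mk x₀ u σ) ↔ perm (mk x₀ u σ) (low i) = low i := by
    rw [fixedPts, Finset.mem_filter]
    simp only [Finset.mem_univ, true_and]
    rfl
  rw [h, perm_mk_low]
  split_ifs with h1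
  · constructor
    · intro h2
      exact absurd h2.symm (low_ne_low_rev _ _)
    · rintro ⟨h2, h3⟩
      rw [h2] at h1
      exact absurd h1 h3
  · rw [low_injective.eq_iff]
    constructor
    · intro h2
      rw [h2] at h1
      exact ⟨h2, h1⟩
    · exact fun h2 => h2.1

theorem low_lt_low_rev (i j : Fin g) : low i < (low j).rev := by
  have hi := i.isLt
  have hj := j.isLt
  rw [Fin.lt_def]
  simp only [low, Fin.val_rev, Fin.val_castLE]
  omega

theorem low_lt_low {i j : Fin g} : low i < low j ↔ i < j := Iff.rfl

theorem exists_low (k : Fin (2 * g)) : (∃ i : Fin g, k = low i) ∨ ∃ i : Fin g, k = (low i).rev := by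
  obtain ⟨a | a, rfl⟩ := (halves g).surjective k
  · exact .inl ⟨a, rfl⟩
  · exact .inr ⟨a, rfl⟩

theorem flips_mk : flips (perm (mk x₀ u σ)) = 2 * Finset.card {i | u i = 1} := by
  have h1 : ∀ i : Fin g, (¬ (low i < (low i).rev ↔
      perm (mk x₀ u σ) (low i) < (perm (mk x₀ u σ) (low i)).rev)) ↔ u (σ i) = 1 := by
    intro i
    rw [perm_mk_low]
    split_ifs with h
    · simp [h, low_lt_low_rev, (low_lt_low_rev _ _).le]
    · simp [h, low_lt_low_rev]
  have h2 : ∀ i : Fin g, (¬ ((low i).rev < (low i).rev.rev ↔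
      perm (mk x₀ u σ) (low i).rev < (perm (mk x₀ u σ) (low i).rev).rev)) ↔ u (σ i) = 1 := by
    intro i
    rw [perm_rev, perm_mk_low, Fin.rev_rev]
    split_ifs with h
    · simp [h, low_lt_low_rev, (low_lt_low_rev _ _).le]
    · simp [h, fun i j : Fin g => (low_lt_low_rev i j).not_gt]
  have h3 : (Finset.card {i | u i = 1} : ℕ) = ∑ i, if u (σ i) = 1 then 1 else 0 := by
    rw [Finset.card_filter, ← Equiv.sum_comp σ]
  rw [flips, Finset.card_filter, sum_eq_sum_low, h3]
  simp only [h1, h2]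
  exact (two_mul _).symm

/-- If only fixed points of `σ` are flipped, and these are not embraced, then crossings in `2g`
points come from crossings of `σ` and of its inverse. -/
theorem crossings_mk_eq_zero (h1 : crossings σ = 0) (h2 : crossings σ⁻¹ = 0)
    (hu : ∀ i, u i = 1 → σ i = i) (he : ∀ i, u i = 1 → ¬ Embraces σ i ∧ ¬ Embraces σ⁻¹ i) :
    crossings (perm (mk x₀ u σ)) = 0 := by
  rw [crossings_eq_zero_iff] at h1 ⊢
  rw [crossings_inv_eq_zero_iff] at h2
  have hfix : ∀ i, u (σ i) = 1 → σ i = i := fun i hi => σ.injective (hu _ hi)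
  intro i j hij hji hw
  rcases exists_low i with ⟨a, rfl⟩ | ⟨a, rfl⟩ <;> rcases exists_low j with ⟨b, rfl⟩ | ⟨b, rfl⟩
  · rw [low_lt_low] at hij
    by_cases ha : u (σ a) = 1
    · rw [perm_mk_low_of_eq ha] at hji hw
      by_cases hb : u (σ b) = 1
      · rw [perm_mk_low_of_eq hb, Fin.rev_lt_rev, low_lt_low, hfix a ha, hfix b hb] at hw
        exact lt_asymm hw hij
      · rw [perm_mk_low_of_ne hb] at hw
        exact lt_asymm hw (low_lt_low_rev _ _)
    · rw [perm_mk_low_of_ne ha] at hji hw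
      rw [low_lt_low] at hji
      by_cases hb : u (σ b) = 1
      · rw [hfix b hb] at hb
        exact (he b hb).1 ⟨a, hij, hji⟩
      · rw [perm_mk_low_of_ne hb, low_lt_low] at hw
        exact h1 a b hij hji hw
  · by_cases ha : u (σ a) = 1
    · rw [perm_mk_low_of_eq ha, hfix a ha] at hji hw
      rw [Fin.rev_lt_rev, low_lt_low] at hji
      rw [hfix a ha] at ha
      by_cases hb : u (σ b) = 1
      · rw [perm_rev, perm_mk_low_of_eq hb, Fin.rev_rev] at hw
        exact lt_asymm hw (low_lt_low_rev _ _)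
      · rw [perm_rev, perm_mk_low_of_ne hb, Fin.rev_lt_rev, low_lt_low] at hw
        -- A flipped a and an unflipped mirror point cross only if σ(b) < a < b, that is, if the
        -- inverse of σ embraces a.
        refine (he a ha).2 ⟨σ b, hw, ?_⟩
        rwa [show σ⁻¹ (σ b) = b from σ.symm_apply_apply b]
    · rw [perm_mk_low_of_ne ha] at hji
      exact lt_asymm hji (low_lt_low_rev _ _)
  · exact lt_asymm hij (low_lt_low_rev _ _)
  · rw [Fin.rev_lt_rev, low_lt_low] at hij
    rw [perm_rev] at hji
    by_cases ha : u (σ a) = 1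
    · rw [perm_mk_low_of_eq ha, Fin.rev_rev] at hji
      exact lt_asymm hji (low_lt_low_rev _ _)
    · rw [perm_mk_low_of_ne ha, Fin.rev_lt_rev, low_lt_low] at hji
      rw [perm_rev, perm_rev, perm_mk_low_of_ne ha, Fin.rev_lt_rev] at hw
      by_cases hb : u (σ b) = 1
      · rw [perm_mk_low_of_eq hb] at hw
        exact lt_asymm hw (low_lt_low_rev _ _)
      · rw [perm_mk_low_of_ne hb, low_lt_low] at hw
        exact h2 b a hw hji hij

theorem perm_mk_low_of_moved (hu : ∀ i, u i = 1 → σ i = i) {i : Fin g} (hi : σ i ≠ i) :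
    perm (mk x₀ u σ) (low i) = low (σ i) :=
  perm_mk_low_of_ne fun h => hi (σ.injective (hu _ h))

theorem noncrossing_of_crossings_mk_eq_zero (h : crossings (perm (mk x₀ u σ)) = 0)
    (hu : ∀ i, u i = 1 → σ i = i) :
    crossings σ = 0 ∧ crossings σ⁻¹ = 0 ∧ ∀ i, u i = 1 → ¬ Embraces σ i := by
  rw [crossings_eq_zero_iff] at h
  rw [crossings_eq_zero_iff, crossings_inv_eq_zero_iff]
  refine ⟨fun i j h1 h2 h3 => ?_, fun i j h1 h2 h3 => ?_, ?_⟩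
  · have hi := perm_mk_low_of_moved (x₀ := x₀) hu (h1.trans h2).ne'
    have hj := perm_mk_low_of_moved (x₀ := x₀) hu (h2.trans h3).ne'
    exact h (low i) (low j) h1 (by rwa [hi]) (by rwa [hi, hj])
  · have hi := perm_mk_low_of_moved (x₀ := x₀) hu (h1.trans h2).ne
    have hj := perm_mk_low_of_moved (x₀ := x₀) hu (h2.trans h3).ne
    refine h (low j).rev (low i).rev (Fin.rev_lt_rev.2 h3) ?_ ?_ <;>
      simp only [perm_rev, hi, hj, Fin.rev_lt_rev]
    · exact h2
    · exact h1
  · rintro e hue ⟨i, h1, h2⟩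
    have hi := perm_mk_low_of_moved (x₀ := x₀) hu (h1.trans h2).ne'
    -- A flipped fixed point is sent to the upper half, beyond σ(i), so an arc embracing it is
    -- crossed.
    refine h (low i) (low e) h1 (by rwa [hi]) ?_
    rw [hi, perm_mk_low_of_eq (by rwa [hu e hue])]
    exact low_lt_low_rev _ _

theorem doubles_mk (hu : ∀ i, ¬ u i = 1) : doubles (perm (mk x₀ u σ)) = 2 * doubles σ := by
  have h1 : ∀ i, perm (mk x₀ u σ) (low i) = low (σ i) := fun i => perm_mk_low_of_ne (hu _)
  have h2 : ∀ i, (perm (mk x₀ u σ))⁻¹ (low i) = low (σ⁻¹ i) := by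
    intro i
    rw [Equiv.Perm.inv_eq_iff_eq, h1, show σ (σ⁻¹ i) = i from σ.apply_symm_apply i]
  have h3 : ∀ i, (perm (mk x₀ u σ))⁻¹ i.rev = ((perm (mk x₀ u σ))⁻¹ i).rev := perm_symm_rev _
  rw [doubles, doubles, Finset.card_filter, Finset.card_filter, sum_eq_sum_low]
  simp only [perm_rev, h1, h2, h3, Fin.rev_lt_rev, low_lt_low]
  refine Eq.trans (congrArg₂ (· + ·) rfl ?_) (two_mul _).symm
  refine Finset.sum_congr rfl fun i _ => if_congr ?_ rfl rfl
  tauto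

theorem apply_apply_of_involutive (h : ∀ i, perm (mk x₀ u σ) (perm (mk x₀ u σ) i) = i) (i : Fin g) :
    σ (σ i) = i := by
  have h1 := h (low i)
  have h2 : ∀ j k : Fin g, perm (mk x₀ u σ) (low j) = low k ∨
      perm (mk x₀ u σ) (low j) = (low k).rev → σ j = k := by
    intro j k hjk
    rw [perm_mk_low] at hjk
    split_ifs at hjk
    · rcases hjk with hjk | hjk
      · exact absurd hjk.symm (low_ne_low_rev _ _)
      · exact low_injective (Fin.rev_injective hjk)
    · rcases hjk with hjk | hjk
      · exact low_injective hjk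
      · exact absurd hjk (low_ne_low_rev _ _)
  apply h2
  rw [perm_mk_low (i := i)] at h1
  split_ifs at h1
  · rw [perm_rev] at h1
    exact .inr (by rw [← h1, Fin.rev_rev])
  · exact .inl h1

theorem perm_mk_involutive (hσ : ∀ i, σ (σ i) = i) (hu : ∀ i, u i = 1 → σ i = i) (k) :
    perm (mk x₀ u σ) (perm (mk x₀ u σ) k) = k := by
  have h : ∀ i, perm (mk x₀ u σ) (perm (mk x₀ u σ) (low i)) = low i := by
    intro i
    by_cases h1 : u (σ i) = 1
    · have h2 := σ.injective (hu _ h1)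
      rw [perm_mk_low_of_eq h1, perm_rev, h2, perm_mk_low_of_eq h1, h2, Fin.rev_rev]
    · rw [perm_mk_low_of_ne h1, perm_mk_low_of_ne, hσ]
      rw [hσ]
      intro h2
      rw [hu i h2] at h1
      exact h1 h2
  rcases exists_low k with ⟨i, rfl⟩ | ⟨i, rfl⟩
  · exact h i
  · rw [perm_rev, perm_rev, h]

theorem card_support_add_card_fixed (σ : Equiv.Perm (Fin g)) :
    σ.support.card + Finset.card {i | σ i = i} = g := by
  have h : σ.support = ({i | σ i = i} : Finset (Fin g))ᶜ := by
    ext i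
    simp
  rw [h, Finset.card_compl_add_card, Fintype.card_fin]

theorem fixedPts_mk_subset : fixedPts (mk x₀ u σ) ⊆ ({i | σ i = i} : Finset (Fin g)) := by
  intro i hi
  rw [Finset.mem_filter]
  exact ⟨Finset.mem_univ _, (mem_fixedPts_mk.1 hi).1⟩

theorem card_support_of_unsigned {d : ℕ} (hd : (fixedPts (mk x₀ u σ)).card = d)
    (hu : ∀ i, ¬ u i = 1) : σ.support.card = g - d := by
  have h : fixedPts (mk x₀ u σ) = ({i | σ i = i} : Finset (Fin g)) := by
    ext i
    rw [mem_fixedPts_mk, Finset.mem_filter]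
    simp [hu]
  have := card_support_add_card_fixed σ
  rw [← h, hd] at this
  omega

/-- With g − d moved points σ has exactly d fixed points, so all of them lie in F(x) and none is
flipped. -/
theorem unsigned_of_card_support {d : ℕ} (hd : (fixedPts (mk x₀ u σ)).card = d) (hdg : d ≤ g)
    (hu : ∀ i, u i = 1 → σ i = i) (hs : σ.support.card = g - d) (i : Fin g) : ¬ u i = 1 := by
  intro hi
  have h1 := card_support_add_card_fixed σ
  have h2 : fixedPts (mk x₀ u σ) = ({i | σ i = i} : Finset (Fin g)) :=
    Finset.eq_of_subset_of_card_le fixedPts_mk_subset (by omega)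
  have h3 : i ∈ fixedPts (mk x₀ u σ) := by
    rw [h2, Finset.mem_filter]
    exact ⟨Finset.mem_univ _, hu i hi⟩
  exact (mem_fixedPts_mk.1 h3).2 hi

theorem flips_mk_eq_zero_iff : flips (perm (mk x₀ u σ)) = 0 ↔ ∀ i, ¬ u i = 1 := by
  rw [flips_mk, mul_eq_zero, or_iff_right two_ne_zero, Finset.card_eq_zero,
    Finset.filter_eq_empty_iff]
  simp

theorem inv_eq_self_of_involutive (h : ∀ i, σ (σ i) = i) : σ⁻¹ = σ := by
  ext i
  rw [Equiv.Perm.inv_eq_iff_eq.2 (h i).symm]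

end Signed

/-! ### The two parities of g − d. -/

theorem maximalLength_even {g d : ℕ} (hd : d ≤ g) {x₀ : cochar g} {u : Fin g → ZMod 2}
    {σ : Equiv.Perm (Fin g)} (hx : mk x₀ u σ ∈ admRank g d) (heven : Even (g - d)) :
    IsOfMaximalLength d (mk x₀ u σ) ↔ PossiblyMaximal x₀ u σ ∧
      IsProdTranspositions σ ((g - d) / 2) ∧ crossings σ = 0 := by
  rw [isOfMaximalLength_iff hd hx, Nat.even_iff.1 heven, excess, crossings_inv_perm]
  have h2 := Nat.two_mul_div_two_of_even heven
  constructor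
  · intro h
    have hu := flips_mk_eq_zero_iff.1 (show flips (perm (mk x₀ u σ)) = 0 by omega)
    have hcr : crossings (perm (mk x₀ u σ)) = 0 := by omega
    have hinv := involutive_of_crossings_eq_zero hcr (by rw [crossings_inv_perm, hcr])
      (by omega : doubles (perm (mk x₀ u σ)) = 0)
    have hu' : ∀ i, u i = 1 → σ i = i := fun i hi => absurd hi (hu i)
    refine ⟨⟨hx.1, hu'⟩, ?_, (noncrossing_of_crossings_mk_eq_zero hcr hu').1⟩
    refine cycleType_eq_replicate (apply_apply_of_involutive hinv) ?_
    rw [card_support_of_unsigned hx.2 hu, h2]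
  · rintro ⟨⟨-, hu⟩, hσ, hcr⟩
    obtain ⟨hinv, hcard⟩ := involutive_of_cycleType hσ
    have hu' := unsigned_of_card_support hx.2 hd hu (hcard.trans h2)
    rw [crossings_mk_eq_zero hcr (by rwa [inv_eq_self_of_involutive hinv]) hu
      (fun i hi => absurd hi (hu' i)), flips_mk_eq_zero_iff.2 hu',
      doubles_eq_zero_of_involutive (perm_mk_involutive hinv hu)]

theorem maximalLength_odd {g d : ℕ} (hd : d ≤ g) {x₀ : cochar g} {u : Fin g → ZMod 2}
    {σ : Equiv.Perm (Fin g)} (hx : mk x₀ u σ ∈ admRank g d) (hodd : Odd (g - d)) :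
    IsOfMaximalLength d (mk x₀ u σ) ↔ PossiblyMaximal x₀ u σ ∧
      ((IsProdTranspositions σ ((g - d) / 2) ∧ crossings σ = 0 ∧
          ∃ e, (∀ i, (σ i = i ∧ i ∉ fixedPts (mk x₀ u σ)) ↔ i = e) ∧ ¬ Embraces σ e) ∨
        (∃ k, k + 1 = (g - d) / 2 ∧ IsProdTranspositionsThreeCycle σ k ∧
          crossings σ = 0 ∧ crossings σ⁻¹ = 0)) := by
  have h2 := Nat.two_mul_div_two_add_one_of_odd hodd
  constructor
  · intro h
    rw [isOfMaximalLength_iff hd hx, Nat.odd_iff.1 hodd, excess, crossings_inv_perm] at h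
    have hcr : crossings (perm (mk x₀ u σ)) = 0 := by omega
    have hcr' := (crossings_inv_perm (mk x₀ u σ)).trans hcr
    have hfl := flips_mk (x₀ := x₀) (u := u) (σ := σ)
    -- The total is 2 and `flips` is even, which leaves one flipped index or two double points of
    -- `w`.
    rcases (by omega : (flips (perm (mk x₀ u σ)) = 2 ∧ doubles (perm (mk x₀ u σ)) = 0) ∨
      (flips (perm (mk x₀ u σ)) = 0 ∧ doubles (perm (mk x₀ u σ)) = 2)) with ⟨h3, h4⟩ | ⟨h3, h4⟩
    · have hinv := involutive_of_crossings_eq_zero hcr hcr' h4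
      have hσ := apply_apply_of_involutive hinv
      obtain ⟨e, he⟩ := Finset.card_eq_one.1 (by omega : Finset.card {i | u i = 1} = 1)
      have hue : ∀ i, u i = 1 ↔ i = e := by
        intro i
        rw [← Finset.mem_singleton (a := e), ← he, Finset.mem_filter]
        simp
      -- If σ(e) ≠ e, then `w` sends σ(e) to the mirror of e but e to σ(e) without flipping, and so
      -- is no involution.
      have hσe : σ e = e := by
        have h5 : perm (mk x₀ u σ) (low (σ e)) = (low e).rev := by
          rw [perm_mk_low_of_eq] <;> rw [hσ]
          exact (hue e).2 rfl
        have h6 := hinv (low (σ e))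
        rw [h5, perm_rev] at h6
        by_contra hne
        rw [perm_mk_low_of_ne (fun h => hne ((hue _).1 h))] at h6
        exact low_ne_low_rev _ _ h6.symm
      have hu : ∀ i, u i = 1 → σ i = i := by
        intro i hi
        rw [(hue i).1 hi, hσe]
      have hnc := noncrossing_of_crossings_mk_eq_zero hcr hu
      have hiff : ∀ i, (σ i = i ∧ i ∉ fixedPts (mk x₀ u σ)) ↔ i = e := by
        intro i
        rw [mem_fixedPts_mk, ← hue]
        constructor
        · rintro ⟨h5, h6⟩
          by_contra h7
          exact h6 ⟨h5, h7⟩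
        · exact fun h5 => ⟨hu i h5, fun h6 => h6.2 h5⟩
      refine ⟨⟨hx.1, hu⟩, .inl ⟨cycleType_eq_replicate hσ ?_, hnc.1, e, hiff,
        hnc.2.2 e ((hue e).2 rfl)⟩⟩
      have h5 : (fixedPts (mk x₀ u σ)) = ({i | σ i = i} : Finset (Fin g)).erase e := by
        ext i
        rw [Finset.mem_erase, mem_fixedPts_mk, Finset.mem_filter, hue]
        simp [and_comm]
      have h6 := card_support_add_card_fixed σ
      have h7 : e ∈ ({i | σ i = i} : Finset (Fin g)) := by simpa using hσe
      have h8 := Finset.card_erase_add_one h7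
      rw [← h5, hx.2] at h8
      omega
    · have hu := flips_mk_eq_zero_iff.1 h3
      have hu' : ∀ i, u i = 1 → σ i = i := fun i hi => absurd hi (hu i)
      have hnc := noncrossing_of_crossings_mk_eq_zero hcr hu'
      rw [doubles_mk hu] at h4
      have hcard := card_support_of_unsigned hx.2 hu
      have h5 : doubles σ = 1 := by omega
      -- For g − d = 1 the permutation σ would move a single point.
      have h6 : 1 ≤ (g - d) / 2 := by
        by_contra! hcon
        have h7 : σ.support.card = 1 := by omega
        exact Equiv.Perm.card_support_ne_one σ h7
      refine ⟨⟨hx.1, hu'⟩, .inr ⟨(g - d) / 2 - 1, by omega,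
        cycleType_of_doubles_eq_one hnc.1 hnc.2.1 h5 (by omega), hnc.1, hnc.2.1⟩⟩
  · have hmod : ∀ n, excess (perm (mk x₀ u σ)) = n → n ≤ 4 →
        IsOfMaximalLength d (mk x₀ u σ) := by
      intro n hn hn4
      rw [isOfMaximalLength_iff hd hx, Nat.odd_iff.1 hodd, hn]
      obtain ⟨t, ht⟩ := Int.even_mul_succ_self (g : ℤ)
      have h3 := four_mul_length_add hx
      have h4 : 2 * (g : ℤ) ^ 2 + 2 * g = 4 * t := by linarith
      rw [excess] at hn
      rw [h4] at h3
      omega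
    rintro ⟨⟨-, hu⟩, ⟨hσ, hcr, e, he, hemb⟩ | ⟨k, hk, hσ, hcr, hcr'⟩⟩
    · obtain ⟨hinv, hcard⟩ := involutive_of_cycleType hσ
      have hσi := inv_eq_self_of_involutive hinv
      have hue : ∀ i, u i = 1 ↔ i = e := by
        intro i
        rw [← he, mem_fixedPts_mk]
        constructor
        · exact fun h5 => ⟨hu i h5, fun h6 => h6.2 h5⟩
        · rintro ⟨h5, h6⟩
          by_contra h7
          exact h6 ⟨h5, h7⟩
      have hfl : Finset.card {i | u i = 1} = 1 := by
        rw [Finset.card_eq_one]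
        exact ⟨e, by ext i; simp [hue]⟩
      refine hmod 2 ?_ (by norm_num)
      rw [excess, crossings_inv_perm, crossings_mk_eq_zero hcr (by rwa [hσi]) hu, flips_mk, hfl,
        doubles_eq_zero_of_involutive (perm_mk_involutive hinv hu)]
      intro i hi
      rw [hσi, (hue i).1 hi]
      exact ⟨hemb, hemb⟩
    · obtain ⟨hdbl, hcard⟩ := doubles_le_of_cycleType hσ
      have hu' := unsigned_of_card_support hx.2 hd hu (by omega)
      refine hmod _ rfl ?_
      rw [excess, crossings_inv_perm, crossings_mk_eq_zero hcr hcr' hu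
        (fun i hi => absurd hi (hu' i)), flips_mk_eq_zero_iff.2 hu', doubles_mk hu']
      omega

end GSp

theorem proposition3 (g d : ℕ) (hd : d ≤ g) (x₀ : GSp.cochar g) (u : Fin g → ZMod 2)
    (σ : Equiv.Perm (Fin g)) (hx : GSp.mk x₀ u σ ∈ GSp.admRank g d) :
    (Even (g - d) →
      (GSp.IsOfMaximalLength d (GSp.mk x₀ u σ) ↔
        GSp.PossiblyMaximal x₀ u σ ∧
        GSp.IsProdTranspositions σ ((g - d) / 2) ∧ GSp.crossings σ = 0)) ∧
    (Odd (g - d) →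
      (GSp.IsOfMaximalLength d (GSp.mk x₀ u σ) ↔
        GSp.PossiblyMaximal x₀ u σ ∧
        ((GSp.IsProdTranspositions σ ((g - d) / 2) ∧ GSp.crossings σ = 0 ∧
            ∃ e, (∀ i, (σ i = i ∧ i ∉ GSp.fixedPts (GSp.mk x₀ u σ)) ↔ i = e) ∧
              ¬ GSp.Embraces σ e) ∨
          (∃ k, k + 1 = (g - d) / 2 ∧ GSp.IsProdTranspositionsThreeCycle σ k ∧
            GSp.crossings σ = 0 ∧ GSp.crossings σ⁻¹ = 0)))) :=
  ⟨GSp.maximalLength_even hd hx, GSp.maximalLength_odd hd hx⟩
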